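/- **Setting.** A *biquandle* is a set $X$ with two binary operations $\underline{*},\overline{*}$ such that: $x\,\underline{*}\,x=x\,\overline{*}\,x$; for each $x$ the maps $\bullet\,\underline{*}\,x$ and $\bullet\,\overline{*}\,x$ are bijective, and $(x,y)\mapsto(y\,\overline{*}\,x,\;x\,\underline{*}\,y)$ is a bijection of $X\times X$; and $(x\underline{*}y)\underline{*}(z\underline{*}y)=(x\underline{*}z)\underline{*}(y\overline{*}z)$, $(x\overline{*}y)\overline{*}(z\overline{*}y)=(x\overline{*}z)\overline{*}(y\underline{*}z)$, $(x\underline{*}y)\overline{*}(z\underline{*}y)=(x\overline{*}z)\underline{*}(y\overline{*}z)$. A quandle $(Q,*)$ is regarded as a biquandle with $x\,\underline{*}\,y=x*y$, $x\,\overline{*}\,y=x$. The quandle $\mathcal Q(X)$ is the set $X$ with $x*y=(x\,\underline{*}\,y)\,\overline{*}^{-1}y$. The group $\mathrm{As}(X)$ has generators $x\in X$ and relations $x\cdot(y\,\overline{*}\,x)=y\cdot(x\,\underline{*}\,y)$. Let $k:X\to X$ be the bijection with $k(x)\,\overline{*}\,k(x)=x$, and let $\psi:\mathrm{As}(\mathcal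 Q(X))\times\mathcal Q(X)\to X$ be the map with $\psi(e,a)=a$, $\psi(p\cdot b,a)=\psi(p,a)\,\overline{*}\,\psi(p,b)$, $\psi(p\cdot b^{-1},a)=\psi(p,a)\,\overline{*}^{-1}k(\psi(p,b))$. Let $A$ be an abelian group. A *biquandle 2-cocycle* is a map $\theta:X\times X\to A$ with $\theta(y,y)=0$ and $$\theta(x_2,x_3)-\theta(x_2\overline{*}x_1,x_3\overline{*}x_1)-\theta(x_1,x_3)+\theta(x_1\underline{*}x_2,x_3\overline{*}x_2)+\theta(x_1,x_2)-\theta(x_1\underline{*}x_3,x_2\underline{*}x_3)=0 .$$ A *shadow quandle 2-cocycle* on a quandle $Q$ is a map $\theta:\mathrm{As}(Q)\times Q\times Q\to A$ with $\theta(p,b,b)=0$ and $$\theta(p,a_2,a_3)-\theta(pa_1,a_2,a_3)-\theta(p,a_1,a_3)+\theta(pa_2,a_1*a_2,a_3)+\theta(p,a_1,a_2)-\theta(pa_3,a_1*a_3,a_2*a_3)=0 .$$ Let $D$ be a planar diagram of an oriented link, taken up to isotopy of the plane, so that it may be put in general position with respect to the height function and cut into horizontal slices each containing one maximum, one minimum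 or one crossing, separated by rows of vertical strings. Strings have normal vectors obtained by rotating the orientation counterclockwise by a right angle. At each crossing there is exactly one adjacent region, the *specified region*, from which the normals of both strings point away. Let $\sigma_i,\sigma_k$ be the two under semi-arcs and $\sigma_j,\sigma_l$ the two over semi-arcs at the crossing, with $\sigma_i,\sigma_j$ bounding the specified region. A biquandle coloring is a map $\mathcal C$ from the semi-arcs to $X$ with $\mathcal C(\sigma_i)\,\underline{*}\,\mathcal C(\sigma_j)=\mathcal C(\sigma_k)$ and $\mathcal C(\sigma_j)\,\overline{*}\,\mathcal C(\sigma_i)=\mathcal C(\sigma_l)$ at every crossing; a quandle coloring is a map $\mathcal C$ from the arcs to $Q$ with $\mathcal C(\sigma_i)*\mathcal C(\sigma_j)=\mathcal C(\sigma_k)$ at every crossing. The sets of colorings are $\mathrm{Col}_X(D)$ and $\mathrm{Col}_Q(D)$. The region coloring $\mathcal C^R$ of a coloring is the unique map from the regions to the associated group that is $e$ on the unbounded region and satisfies $\mathcal C^R(R_1)\cdot\mathcal C(\sigma)=\mathcal C^R(R_2)$ whenever the normal of $\sigma$ points from $R_1$ to $R_2$. A crossing with sign $\epsilon$ and specified region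 $R$ has weight $\epsilon\,\theta(\mathcal C(\sigma_i),\mathcal C(\sigma_j))$ for a biquandle 2-cocycle $\theta$ and $\mathcal C\in\mathrm{Col}_X(D)$, and weight $\epsilon\,\theta(\mathcal C^R(R),\mathcal C(\sigma_i),\mathcal C(\sigma_j))$ for a shadow quandle 2-cocycle $\theta$ and $\mathcal C\in\mathrm{Col}_Q(D)$. The sums of the weights over all crossings are the invariants $(\Phi_\theta(D))(\mathcal C)$ and $(\Phi^S_\theta(D))(\mathcal C)$. If $X$ (resp. $Q$) is finite, $\Phi_\theta(D)$ (resp. $\Phi^S_\theta(D)$) also denotes the sum in $\mathbb Z[A]$, over all colorings, of the basis elements given by these values. For $\mathcal C\in\mathrm{Col}_{\mathcal Q(X)}(D)$, put behind every string of $D$ a copy with the opposite orientation, pushed slightly in the normal direction, and give each string and its copy in each row of vertical strings the color that $\mathcal C$ gives to the arc. In each row pull the copies away to the right, behind all other strings they meet: first the copy of the leftmost string to the far right, then the copy of the second string to the left of that one, and so on. Extending the biquandle coloring through these crossings leaves colors in $X$ on the strings of $D$. Write $\Psi(\mathcal C)$ for the resulting assignment of colors. **Theorem.** Let $X$ be a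 biquandle, $A$ an abelian group and $\theta:X\times X\to A$ a biquandle 2-cocycle. Then $(\psi^*\theta)(p,a,b):=\theta(\psi(p,a),\psi(p,b))$ is a shadow quandle 2-cocycle on $\mathcal Q(X)$. For every diagram $D$ of an oriented link, $\Psi$ is a well-defined bijection $\mathrm{Col}_{\mathcal Q(X)}(D)\to\mathrm{Col}_X(D)$, and for every $\mathcal C\in\mathrm{Col}_{\mathcal Q(X)}(D)$ the weight of each crossing with respect to $\Psi(\mathcal C)$ and $\theta$ equals its weight with respect to $\mathcal C$ and $\psi^*\theta$; hence $(\Phi_\theta(D))(\Psi(\mathcal C))=(\Phi^S_{\psi^*\theta}(D))(\mathcal C)$. In particular, if $X$ is finite, $\Phi_\theta(D)=\Phi^S_{\psi^*\theta}(D)$ in $\mathbb Z[A]$. -/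

import Mathlib

open Function

namespace BiquandleLink

universe u v

/-! ### Biquandles -/

/-- A biquandle. Here `underOp x y` is the underlined product of `x` and `y` and `overOp x y` is the
overlined product of `x` and `y`. -/
class Biquandle (X : Type u) where
  underOp : X → X → X
  overOp : X → X → X
  under_self : ∀ x, underOp x x = overOp x x
  under_bijective : ∀ x, Bijective fun z => underOp z x
  over_bijective : ∀ x, Bijective fun z => overOp z x
  switch_bijective : Bijective fun p : X × X => (overOp p.2 p.1, underOp p.1 p.2)
  under_under : ∀ x y z,
    underOp (underOp x y) (underOp z y) = underOp (underOp x z) (overOp y z)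
  over_over : ∀ x y z,
    overOp (overOp x y) (overOp z y) = overOp (overOp x z) (underOp y z)
  under_over : ∀ x y z,
    overOp (underOp x y) (underOp z y) = underOp (overOp x z) (overOp y z)

open Biquandle

section Basic

variable {X : Type u} [Biquandle X]

/-- The permutation `z ↦ overOp z x`. -/
noncomputable def overPerm (x : X) : Equiv.Perm X := Equiv.ofBijective _ (over_bijective x)

/-- The inverse operation: `overInv z x` is the unique `w` with `overOp w x = z`. -/
noncomputable def overInv (z x : X) : X := (overPerm x).symm z

/-- The permutation `z ↦ underOp z x`. -/
noncomputable def underPerm (x : X) : Equiv.Perm X := Equiv.ofBijective _ (under_bijective x)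

/-- The inverse operation: `underInv z x` is the unique `w` with `underOp w x = z`. -/
noncomputable def underInv (z x : X) : X := (underPerm x).symm z

theorem over_overInv (z x : X) : overOp (overInv z x) x = z :=
  (overPerm x).apply_symm_apply z

theorem overInv_over (z x : X) : overInv (overOp z x) x = z :=
  (overPerm x).symm_apply_apply z

theorem under_underInv (z x : X) : underOp (underInv z x) x = z :=
  (underPerm x).apply_symm_apply z

theorem underInv_under (z x : X) : underInv (underOp z x) x = z :=
  (underPerm x).symm_apply_apply z

theorem over_right_cancel {x y z : X} (h : overOp x z = overOp y z) : x = y :=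
  (over_bijective z).1 h

theorem over_self_bijective : Bijective fun x : X => overOp x x := by
  constructor
  · intro x y h
    have h' : overOp x x = overOp y y := h
    have : (x, x) = (y, y) := switch_bijective.1 (by
      show (overOp x x, underOp x x) = (overOp y y, underOp y y)
      rw [under_self, under_self, h'])
    exact congrArg Prod.fst this
  · intro z
    obtain ⟨⟨x, y⟩, h⟩ := (switch_bijective (X := X)).2 (z, z)
    have h1 : overOp y x = z := congrArg Prod.fst h
    have h2 : underOp x y = z := congrArg Prod.snd h
    have h3 := over_over y x y
    rw [h2, h1] at h3
    have h4 : overOp y y = z := (over_right_cancel h3).symm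
    exact ⟨y, h4⟩

/-- The bijection `k : X → X` with `overOp (k x) (k x) = x`. -/
noncomputable def kMap : Equiv.Perm X := (Equiv.ofBijective _ (over_self_bijective (X := X))).symm

theorem over_kMap (x : X) : overOp (kMap x) (kMap x) = x :=
  (Equiv.ofBijective _ (over_self_bijective (X := X))).apply_symm_apply x

theorem kMap_over (x : X) : kMap (overOp x x) = x :=
  (Equiv.ofBijective _ (over_self_bijective (X := X))).symm_apply_apply x

/-- The derived operation on a biquandle. -/
noncomputable def derived (x y : X) : X := overInv (underOp x y) y

theorem over_derived (x y : X) : overOp (derived x y) y = underOp x y := over_overInv _ _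

theorem derived_over (x y c : X) : derived (overOp x c) (overOp y c) = overOp (derived x y) c := by
  apply over_right_cancel (z := overOp y c)
  rw [over_derived, over_over, over_derived, under_over]

theorem derived_under (x y c : X) : derived (underOp x c) (underOp y c) = underOp (derived x y) c := by
  apply over_right_cancel (z := underOp y c)
  rw [over_derived, under_under, under_over, over_derived]

theorem derived_derived (x y c : X) :
    derived (derived x y) c = derived (derived x c) (derived y c) := by
  apply over_right_cancel (z := c)
  rw [over_derived, ← derived_over, over_derived, over_derived, derived_under]

theorem derived_self (x : X) : derived x x = x := by
  rw [derived, under_self, overInv_over]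

end Basic

/-- The quandle `Q(X)` associated with a biquandle `X`. Its underlying set is a copy of `X`, with
`Qdl.of : X → Qdl X` and `Qdl.val : Qdl X → X` the identity maps. -/
@[ext] structure Qdl (X : Type u) where of ::
  val : X

instance (X : Type u) [Finite X] : Finite (Qdl X) :=
  Finite.of_injective Qdl.val fun _ _ => Qdl.ext

/-- The product of `a` and `b` in `Q(X)` is `derived a b`. Mathlib writes the quandle operation on
the other side: the product of `a` and `b`, in the convention in which `b` acts from the right, is
`Shelf.act b a`. -/
noncomputable instance (X : Type u) [Biquandle X] : Quandle (Qdl X) where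
  act b a := ⟨derived a.val b.val⟩
  self_distrib := Qdl.ext (derived_derived _ _ _)
  invAct b a := ⟨underInv (overOp a.val b.val) b.val⟩
  left_inv b a := Qdl.ext (by
    show underInv (overOp (derived a.val b.val) b.val) b.val = a.val
    rw [over_derived, underInv_under])
  right_inv b a := Qdl.ext (by
    show overInv (underOp (underInv (overOp a.val b.val) b.val) b.val) b.val = a.val
    rw [under_underInv, overInv_over])
  fix := Qdl.ext (derived_self _)

/-- A quandle is a biquandle whose overlined product is trivial. -/
instance Quandle.toBiquandle (Q : Type u) [Quandle Q] : Biquandle Q where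
  underOp x y := Shelf.act y x
  overOp x _ := x
  under_self x := Quandle.fix
  under_bijective x := ⟨(Rack.left_inv x).injective, (Rack.right_inv x).surjective⟩
  over_bijective _ := bijective_id
  switch_bijective := by
    constructor
    · rintro ⟨x, y⟩ ⟨x', y'⟩ h
      obtain ⟨h1, h2⟩ := Prod.mk.inj h
      simp only at h1 h2
      subst h1
      rw [(Rack.left_inv y).injective h2]
    · rintro ⟨y, w⟩
      exact ⟨(Rack.invAct y w, y), Prod.ext rfl (Rack.right_inv y w)⟩
  under_under _ _ _ := Shelf.self_distrib.symm
  over_over _ _ _ := rfl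
  under_over _ _ _ := rfl

/-! ### The associated group and the map `ψ` -/

/-- The relators of the associated group. -/
def assocRels (X : Type u) [Biquandle X] : Set (FreeGroup X) :=
  {r | ∃ x y : X, r = (FreeGroup.of x * FreeGroup.of (overOp y x)) *
    (FreeGroup.of y * FreeGroup.of (underOp x y))⁻¹}

/-- The associated group `As(X)` of a biquandle (hence also of a quandle). -/
abbrev As (X : Type u) [Biquandle X] : Type u := PresentedGroup (assocRels X)

/-- The generator of `As(X)` given by an element of `X`. -/
def gen {X : Type u} [Biquandle X] (x : X) : As X := PresentedGroup.of x

theorem gen_mul_gen {X : Type u} [Biquandle X] (x y : X) :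
    gen x * gen (overOp y x) = gen y * gen (underOp x y) := by
  have h : (PresentedGroup.mk (assocRels X)) ((FreeGroup.of x * FreeGroup.of (overOp y x)) *
      (FreeGroup.of y * FreeGroup.of (underOp x y))⁻¹) = 1 :=
    PresentedGroup.one_of_mem ⟨x, y, rfl⟩
  rw [map_mul, map_inv, mul_inv_eq_one, map_mul, map_mul] at h
  exact h

section Psi

variable {X : Type u} [Biquandle X]

variable (X) in
/-- The endomorphisms of `Q(X)`, as maps `X → X`. -/
abbrev DerivedEnd : Type u := {f : X → X // ∀ x y, f (derived x y) = derived (f x) (f y)}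

theorem derived_overInv (x y c : X) :
    derived (overInv x c) (overInv y c) = overInv (derived x y) c := by
  apply over_right_cancel (z := c)
  rw [← derived_over, over_overInv, over_overInv, over_overInv]

/-- The permutation `f ↦ (a ↦ overOp (f a) (f b))` of the endomorphisms of `Q(X)`; its inverse is
`f ↦ (a ↦ overInv (f a) (k (f b)))`. -/
noncomputable def psiStep (b : X) : Equiv.Perm (DerivedEnd X) where
  toFun f := ⟨fun a => overOp (f.1 a) (f.1 b), fun x y => by beta_reduce; rw [f.2, derived_over]⟩
  invFun f := ⟨fun a => overInv (f.1 a) (kMap (f.1 b)), fun x y => by beta_reduce; rw [f.2, derived_overInv]⟩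
  left_inv f := by
    apply Subtype.ext
    funext a
    simp only [kMap_over, overInv_over]
  right_inv f := by
    apply Subtype.ext
    funext a
    have : overInv (f.1 b) (kMap (f.1 b)) = kMap (f.1 b) :=
      over_right_cancel ((over_overInv _ _).trans (over_kMap _).symm)
    simp only [this, over_overInv]

/-- The right action of `As(Q(X))` on the endomorphisms of `Q(X)` in which `b` acts by
`psiStep b`. -/
noncomputable def psiHom : As (Qdl X) →* (Equiv.Perm (DerivedEnd X))ᵐᵒᵖ :=
  PresentedGroup.toGroup (f := fun b : Qdl X => MulOpposite.op (psiStep b.val)) (by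
    rintro r ⟨x, y, rfl⟩
    rw [map_mul, map_inv, mul_inv_eq_one, map_mul, map_mul]
    simp only [FreeGroup.lift_apply_of]
    rw [← MulOpposite.op_mul, ← MulOpposite.op_mul]
    congr 1
    apply Equiv.ext
    intro f
    apply Subtype.ext
    funext a
    show overOp (overOp (f.1 a) (f.1 x.val)) (overOp (f.1 y.val) (f.1 x.val)) =
      overOp (overOp (f.1 a) (f.1 y.val)) (overOp (f.1 (derived x.val y.val)) (f.1 y.val))
    rw [f.2, over_derived, over_over])

/-- The map `ψ : As(Q(X)) × Q(X) → X`; its inductive description is `psi_one`, `psi_mul_gen` and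
`psi_mul_gen_inv`. -/
noncomputable def psi (p : As (Qdl X)) (a : Qdl X) : X :=
  ((psiHom p).unop ⟨id, fun _ _ => rfl⟩).1 a.val

theorem psiHom_gen (b : Qdl X) : psiHom (gen b) = MulOpposite.op (psiStep b.val) :=
  PresentedGroup.toGroup.of _

theorem psi_one (a : Qdl X) : psi 1 a = a.val := by
  simp only [psi, map_one]
  rfl

theorem psi_mul_gen (p : As (Qdl X)) (a b : Qdl X) :
    psi (p * gen b) a = overOp (psi p a) (psi p b) := by
  simp only [psi, map_mul, psiHom_gen]
  rfl

theorem psi_mul_gen_inv (p : As (Qdl X)) (a b : Qdl X) :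
    psi (p * (gen b)⁻¹) a = overInv (psi p a) (kMap (psi p b)) := by
  simp only [psi, map_mul, map_inv, psiHom_gen]
  rfl

end Psi

/-! ### Cocycles -/

section Cocycles

variable {A : Type v} [AddCommGroup A]

/-- Biquandle 2-cocycles. -/
structure IsBiquandleCocycle {X : Type u} [Biquandle X] (θ : X × X → A) : Prop where
  cocycle : ∀ x₁ x₂ x₃ : X,
    (θ (x₂, x₃) - θ (overOp x₂ x₁, overOp x₃ x₁))
      - (θ (x₁, x₃) - θ (underOp x₁ x₂, overOp x₃ x₂))
      + (θ (x₁, x₂) - θ (underOp x₁ x₃, underOp x₂ x₃)) = 0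
  degenerate : ∀ y : X, θ (y, y) = 0

/-- Shadow quandle 2-cocycles; `Shelf.act b a` is the product of `a` and `b` in the quandle. -/
structure IsShadowCocycle {Q : Type u} [Quandle Q] (θ : As Q × Q × Q → A) : Prop where
  cocycle : ∀ (p : As Q) (a₁ a₂ a₃ : Q),
    (θ (p, a₂, a₃) - θ (p * gen a₁, a₂, a₃))
      - (θ (p, a₁, a₃) - θ (p * gen a₂, Shelf.act a₂ a₁, a₃))
      + (θ (p, a₁, a₂) - θ (p * gen a₃, Shelf.act a₃ a₁, Shelf.act a₃ a₂)) = 0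
  degenerate : ∀ (p : As Q) (b : Q), θ (p, b, b) = 0

/-- The pullback of `θ` by `ψ`. -/
noncomputable def pullback {X : Type u} [Biquandle X] (θ : X × X → A) :
    As (Qdl X) × Qdl X × Qdl X → A :=
  fun t => θ (psi t.1 t.2.1, psi t.1 t.2.2)

end Cocycles

/-! ### Oriented link diagrams

A diagram in the plane is put in general position with respect to the height function and cut into
horizontal slices, each of which holds one maximum, one minimum or one crossing. Between two
consecutive slices the diagram is a row of vertical strings, recorded from left to right by their
orientations: `true` for a string oriented downward and `false` for one oriented upward. -/

/-- The type of a slice. In `cross leftOver` the two strings starting at the upper left and the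
upper right cross, and `leftOver` says that the one from the upper left to the lower right is the
over-string. -/
inductive SliceKind
  | max
  | min
  | cross (leftOver : Bool)
  deriving DecidableEq

/-- A slice: its type and the number of strings to the left of the event. -/
structure Slice where
  kind : SliceKind
  pos : ℕ

/-- `s.Fits t b`: the slice `s` has the row `t` at its top and the row `b` at its bottom. -/
def Slice.Fits (s : Slice) (t b : List Bool) : Prop :=
  ∃ l r : List Bool, l.length = s.pos ∧
    match s.kind with
    | .max => ∃ ε, t = l ++ r ∧ b = l ++ ε :: (!ε) :: r
    | .min => ∃ ε, t = l ++ ε :: (!ε) :: r ∧ b = l ++ r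
    | .cross _ => ∃ ε δ, t = l ++ ε :: δ :: r ∧ b = l ++ δ :: ε :: r

/-- An oriented link diagram in the plane, read from top to bottom. -/
structure LinkDiagram where
  /-- the number of slices -/
  len : ℕ
  slice : Fin len → Slice
  /-- the rows of vertical strings above, between and below the slices -/
  row : Fin (len + 1) → List Bool
  fits : ∀ k : Fin len, (slice k).Fits (row k.castSucc) (row k.succ)
  row_zero : row 0 = []
  row_last : row (Fin.last len) = []

/-- String number `i` of the upper row is string number `j` of the lower row, and is not involved
in the event of the slice. -/
def Slice.StringPass (s : Slice) (i j : ℕ) : Prop :=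
  match s.kind with
  | .max => (i < s.pos ∧ j = i) ∨ (s.pos ≤ i ∧ j = i + 2)
  | .min => (i < s.pos ∧ j = i) ∨ (s.pos ≤ j ∧ i = j + 2)
  | .cross _ => (i < s.pos ∨ s.pos + 2 ≤ i) ∧ j = i

/-- Gap number `g` of the upper row and gap number `h` of the lower row are in the same component
of the complement of the slice. Gap number `g` has `g` strings on its left. -/
def Slice.GapPass (s : Slice) (g h : ℕ) : Prop :=
  match s.kind with
  | .max => (g ≤ s.pos ∧ h = g) ∨ (s.pos ≤ g ∧ h = g + 2)
  | .min => (g ≤ s.pos ∧ h = g) ∨ (s.pos ≤ h ∧ g = h + 2)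
  | .cross _ => g ≠ s.pos + 1 ∧ h = g

namespace LinkDiagram

variable (D : LinkDiagram)

/-- The pieces (vertical strings) of the curves of the diagram. -/
abbrev Piece : Type := Σ k : Fin (D.len + 1), Fin (D.row k).length

/-- The orientation of a piece: `true` if it is oriented downward. -/
def down (s : D.Piece) : Bool := (D.row s.1)[s.2]

/-- Two pieces that are connected within a slice without going through the crossing. -/
inductive Joined : D.Piece → D.Piece → Prop
  | pass (k : Fin D.len) (i : Fin (D.row k.castSucc).length) (j : Fin (D.row k.succ).length)
      (h : (D.slice k).StringPass i j) : Joined ⟨k.castSucc, i⟩ ⟨k.succ, j⟩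
  | max (k : Fin D.len) (i j : Fin (D.row k.succ).length) (h : (D.slice k).kind = .max)
      (hi : (i : ℕ) = (D.slice k).pos) (hj : (j : ℕ) = (D.slice k).pos + 1) :
      Joined ⟨k.succ, i⟩ ⟨k.succ, j⟩
  | min (k : Fin D.len) (i j : Fin (D.row k.castSucc).length) (h : (D.slice k).kind = .min)
      (hi : (i : ℕ) = (D.slice k).pos) (hj : (j : ℕ) = (D.slice k).pos + 1) :
      Joined ⟨k.castSucc, i⟩ ⟨k.castSucc, j⟩

/-- Two pieces that are connected within a slice, possibly by the over-string of a crossing. -/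
inductive OverJoined : D.Piece → D.Piece → Prop
  | joined {s t : D.Piece} (h : D.Joined s t) : OverJoined s t
  | leftOver (k : Fin D.len) (i : Fin (D.row k.castSucc).length) (j : Fin (D.row k.succ).length)
      (h : (D.slice k).kind = .cross true)
      (hi : (i : ℕ) = (D.slice k).pos) (hj : (j : ℕ) = (D.slice k).pos + 1) :
      OverJoined ⟨k.castSucc, i⟩ ⟨k.succ, j⟩
  | rightOver (k : Fin D.len) (i : Fin (D.row k.castSucc).length) (j : Fin (D.row k.succ).length)
      (h : (D.slice k).kind = .cross false)
      (hi : (i : ℕ) = (D.slice k).pos + 1) (hj : (j : ℕ) = (D.slice k).pos) :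
      OverJoined ⟨k.castSucc, i⟩ ⟨k.succ, j⟩

/-- The set of semi-arcs of the diagram. -/
def SemiArc : Type := Quot D.Joined

/-- The set of arcs of the diagram. -/
def Arc : Type := Quot D.OverJoined

/-- The semi-arc that contains a piece. -/
def semiArc (s : D.Piece) : D.SemiArc := Quot.mk _ s

/-- The natural surjection from the semi-arcs to the arcs. -/
def toArc : D.SemiArc → D.Arc :=
  Quot.lift (fun s => Quot.mk _ s) fun _ _ h => Quot.sound (.joined h)

/-- The pieces (gaps of the rows) of the complement of the diagram. -/
abbrev Gap : Type := Σ k : Fin (D.len + 1), Fin ((D.row k).length + 1)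

/-- Two gaps that are connected within a slice. -/
inductive GapJoined : D.Gap → D.Gap → Prop
  | pass (k : Fin D.len) (g : Fin ((D.row k.castSucc).length + 1))
      (h : Fin ((D.row k.succ).length + 1)) (hgh : (D.slice k).GapPass g h) :
      GapJoined ⟨k.castSucc, g⟩ ⟨k.succ, h⟩

/-- The set of regions of the diagram. -/
def Region : Type := Quot D.GapJoined

/-- The region that contains a gap. -/
def region (g : D.Gap) : D.Region := Quot.mk _ g

/-- The unbounded region. -/
def unbounded : D.Region := D.region ⟨0, 0⟩

/-- The gap at a piece from which the normal vector of the piece points. The normal vector is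
the direction of the orientation rotated counterclockwise by a right angle, so it points to the
right for a string oriented downward. -/
def source (s : D.Piece) : D.Gap := ⟨s.1, if D.down s then s.2.castSucc else s.2.succ⟩

/-- The gap at a piece to which the normal vector of the piece points. -/
def target (s : D.Piece) : D.Gap := ⟨s.1, if D.down s then s.2.succ else s.2.castSucc⟩

/-- The set of crossings of the diagram: a slice that is a crossing, and its over-under
information. -/
def Crossing : Type := {c : Fin D.len × Bool // (D.slice c.1).kind = .cross c.2}

noncomputable instance : Fintype D.Crossing := by unfold Crossing; infer_instance

end LinkDiagram

/-! ### Crossings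

At a crossing with under-string `u` and over-string `o` there is a unique quadrant from which the
normal vectors of both strings point away; call it the specified quadrant. The ends
`i`, `k` are the two halves of `u` and the ends `j`, `l` the two halves of `o`, where `i` and `j`
are the ones that bound the specified quadrant. -/

/-- The data attached to the four ends of a crossing. -/
structure Ends (α : Type*) where
  i : α
  j : α
  k : α
  l : α

/-- Apply a map to the data at the four ends. -/
def Ends.map {α β : Type*} (f : α → β) (e : Ends α) : Ends β := ⟨f e.i, f e.j, f e.k, f e.l⟩

/-- The four ends of a crossing. The two strings are `NW-SE` and `NE-SW`; `leftOver` says that the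
string `NW-SE` is the over-string, and `ε`, `δ` say that `NW-SE`, `NE-SW` respectively are oriented
downward. -/
def crossingEnds {α : Type*} (leftOver ε δ : Bool) (nw ne sw se : α) : Ends α :=
  let nearA := if δ then nw else se
  let farA := if δ then se else nw
  let nearB := if ε then sw else ne
  let farB := if ε then ne else sw
  if leftOver then ⟨nearB, nearA, farB, farA⟩ else ⟨nearA, nearB, farA, farB⟩

/-- The specified quadrant of a crossing. -/
def specifiedQuadrant {α : Type*} (ε δ : Bool) (north south west east : α) : α :=
  if ε then (if δ then west else south) else (if δ then north else east)

/-- The sign of a crossing: `1` if the directions of the over-string and the under-string, in this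
order, form a positively oriented basis of the plane, and `-1` otherwise. -/
def crossingSign (leftOver ε δ : Bool) : ℤ :=
  if leftOver = (ε == δ) then -1 else 1

/-- The rule for the biquandle colors of the four ends of a crossing. -/
def ColorRule {X : Type u} [Biquandle X] (e : Ends X) : Prop :=
  underOp e.i e.j = e.k ∧ overOp e.j e.i = e.l

theorem crossingEnds_map {α β : Type*} (f : α → β) (leftOver ε δ : Bool) (nw ne sw se : α) :
    (crossingEnds leftOver ε δ nw ne sw se).map f =
      crossingEnds leftOver ε δ (f nw) (f ne) (f sw) (f se) := by
  cases leftOver <;> cases ε <;> cases δ <;> rfl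

/-- The colors of the four ends are compatible with the region colors. -/
theorem ColorRule.letters {X : Type u} [Biquandle X] {leftOver ε δ : Bool} {nw ne sw se : X}
    (h : ColorRule (crossingEnds leftOver ε δ nw ne sw se)) :
    (if ε then gen nw else (gen nw)⁻¹) * (if δ then gen ne else (gen ne)⁻¹) =
      (if δ then gen sw else (gen sw)⁻¹) * (if ε then gen se else (gen se)⁻¹) := by
  have key := gen_mul_gen (crossingEnds leftOver ε δ nw ne sw se).i
    (crossingEnds leftOver ε δ nw ne sw se).j
  rw [h.1, h.2] at key
  cases leftOver <;> cases ε <;> cases δ <;>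
    simp only [crossingEnds, if_true, if_false, Bool.false_eq_true] at key ⊢
  all_goals
    first
    | exact key
    | exact key.symm
    | rw [← mul_inv_rev, ← mul_inv_rev, key]
    | rw [inv_mul_eq_iff_eq_mul, ← mul_assoc, eq_mul_inv_iff_mul_eq, key]
    | rw [mul_inv_eq_iff_eq_mul, mul_assoc, eq_inv_mul_iff_mul_eq, key]

namespace LinkDiagram

variable (D : LinkDiagram)

theorem crossing_row (c : D.Crossing) :
    (D.slice c.1.1).pos + 1 < (D.row c.1.1.castSucc).length ∧
    (D.slice c.1.1).pos + 1 < (D.row c.1.1.succ).length := by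
  obtain ⟨l, r, hl, h⟩ := D.fits c.1.1
  rw [c.2] at h
  obtain ⟨ε, δ, h1, h2⟩ := h
  rw [h1, h2]
  simp only [List.length_append, List.length_cons, hl]
  omega

variable {D}

namespace Crossing

/-- The upper left end of a crossing. -/
def nw (c : D.Crossing) : D.Piece :=
  ⟨c.1.1.castSucc, (D.slice c.1.1).pos, by have := D.crossing_row c; omega⟩

/-- The upper right end of a crossing. -/
def ne (c : D.Crossing) : D.Piece :=
  ⟨c.1.1.castSucc, (D.slice c.1.1).pos + 1, by have := D.crossing_row c; omega⟩

/-- The lower left end of a crossing. -/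
def sw (c : D.Crossing) : D.Piece :=
  ⟨c.1.1.succ, (D.slice c.1.1).pos, by have := D.crossing_row c; omega⟩

/-- The lower right end of a crossing. -/
def se (c : D.Crossing) : D.Piece :=
  ⟨c.1.1.succ, (D.slice c.1.1).pos + 1, by have := D.crossing_row c; omega⟩

/-- The gap on the left of a crossing. -/
def west (c : D.Crossing) : D.Gap :=
  ⟨c.1.1.castSucc, (D.slice c.1.1).pos, by have := D.crossing_row c; omega⟩

/-- The gap on the right of a crossing. -/
def east (c : D.Crossing) : D.Gap :=
  ⟨c.1.1.castSucc, (D.slice c.1.1).pos + 2, by have := D.crossing_row c; omega⟩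

/-- The gap above a crossing. -/
def north (c : D.Crossing) : D.Gap :=
  ⟨c.1.1.castSucc, (D.slice c.1.1).pos + 1, by have := D.crossing_row c; omega⟩

/-- The gap below a crossing. -/
def south (c : D.Crossing) : D.Gap :=
  ⟨c.1.1.succ, (D.slice c.1.1).pos + 1, by have := D.crossing_row c; omega⟩

/-- The four semi-arcs around a crossing. -/
def ends (c : D.Crossing) : Ends D.SemiArc :=
  crossingEnds c.1.2 (D.down c.nw) (D.down c.ne)
    (D.semiArc c.nw) (D.semiArc c.ne) (D.semiArc c.sw) (D.semiArc c.se)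

/-- The specified region at a crossing. -/
def specified (c : D.Crossing) : D.Region :=
  D.region (specifiedQuadrant (D.down c.nw) (D.down c.ne) c.north c.south c.west c.east)

/-- The sign of a crossing. -/
def sign (c : D.Crossing) : ℤ := crossingSign c.1.2 (D.down c.nw) (D.down c.ne)

end Crossing

/-! ### Colorings -/

variable (D)

/-- The set of biquandle colorings of `D` by `X`. -/
def BiquandleColoring (X : Type u) [Biquandle X] : Type u :=
  {C : D.SemiArc → X // ∀ c : D.Crossing,
    ColorRule ((c.ends).map C)}

/-- The set of quandle colorings of `D` by `Q`. -/
def QuandleColoring (Q : Type u) [Quandle Q] : Type u :=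
  {C : D.Arc → Q // ∀ c : D.Crossing,
    Shelf.act (C (D.toArc c.ends.j)) (C (D.toArc c.ends.i)) = C (D.toArc c.ends.k)}

instance : Finite D.SemiArc := by unfold SemiArc; infer_instance

instance : Finite D.Arc := by unfold Arc; infer_instance

instance (X : Type u) [Biquandle X] [Finite X] : Finite (D.BiquandleColoring X) := by
  unfold BiquandleColoring; infer_instance

instance (Q : Type u) [Quandle Q] [Finite Q] : Finite (D.QuandleColoring Q) := by
  unfold QuandleColoring; infer_instance

variable {D}

theorem Crossing.toArc_l (c : D.Crossing) : D.toArc c.ends.l = D.toArc c.ends.j := by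
  have key : D.toArc c.ends.j = D.toArc c.ends.l ∨ D.toArc c.ends.l = D.toArc c.ends.j := by
    obtain ⟨⟨k, b⟩, hb⟩ := c
    cases b
    · have h : D.toArc (D.semiArc (Crossing.ne ⟨(k, false), hb⟩)) =
          D.toArc (D.semiArc (Crossing.sw ⟨(k, false), hb⟩)) :=
        Quot.sound (.rightOver k _ _ hb rfl rfl)
      cases hd : D.down (Crossing.nw ⟨(k, false), hb⟩) <;>
        simp [Crossing.ends, crossingEnds, hd, h]
    · have h : D.toArc (D.semiArc (Crossing.nw ⟨(k, true), hb⟩)) =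
          D.toArc (D.semiArc (Crossing.se ⟨(k, true), hb⟩)) :=
        Quot.sound (.leftOver k _ _ hb rfl rfl)
      cases hd : D.down (Crossing.ne ⟨(k, true), hb⟩) <;>
        simp [Crossing.ends, crossingEnds, hd, h]
  exact key.elim Eq.symm id

/-- A quandle coloring, considered as a biquandle coloring. -/
def QuandleColoring.toBiquandle {Q : Type u} [Quandle Q] (C : D.QuandleColoring Q) :
    D.BiquandleColoring Q :=
  ⟨fun σ => C.1 (D.toArc σ), fun c => ⟨C.2 c, (congrArg C.1 c.toArc_l).symm⟩⟩

/-! ### Region colorings -/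

/-- A region coloring with respect to a biquandle coloring. -/
structure IsRegionColoring {X : Type u} [Biquandle X] (C : D.BiquandleColoring X)
    (R : D.Region → As X) : Prop where
  unbounded : R D.unbounded = 1
  cross : ∀ s : D.Piece,
    R (D.region (D.source s)) * gen (C.1 (D.semiArc s)) = R (D.region (D.target s))

section RegionColoring

variable {X : Type u} [Biquandle X] (C : D.BiquandleColoring X)

theorem _root_.BiquandleLink.Slice.Fits.getElem?_pass {s : Slice} {t b : List Bool}
    (h : s.Fits t b) {i j : ℕ} (hij : s.StringPass i j) : t[i]? = b[j]? := by
  obtain ⟨l, r, hl, h⟩ := h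
  unfold Slice.StringPass at hij
  split at h
  · rename_i hk
    obtain ⟨ε, rfl, rfl⟩ := h
    simp only [hk] at hij
    rcases hij with ⟨h1, rfl⟩ | ⟨h1, rfl⟩
    · rw [List.getElem?_append_left (by omega), List.getElem?_append_left (by omega)]
    · rw [List.getElem?_append_right (by omega), List.getElem?_append_right (by omega),
        show i + 2 - l.length = (i - l.length) + 1 + 1 by omega]
      simp
  · rename_i hk
    obtain ⟨ε, rfl, rfl⟩ := h
    simp only [hk] at hij
    rcases hij with ⟨h1, rfl⟩ | ⟨h1, rfl⟩
    · rw [List.getElem?_append_left (by omega), List.getElem?_append_left (by omega)]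
    · rw [List.getElem?_append_right (by omega), List.getElem?_append_right (by omega),
        show j + 2 - l.length = (j - l.length) + 1 + 1 by omega]
      simp
  · rename_i hk
    obtain ⟨ε, δ, rfl, rfl⟩ := h
    simp only [hk] at hij
    obtain ⟨h1 | h1, rfl⟩ := hij
    · rw [List.getElem?_append_left (by omega), List.getElem?_append_left (by omega)]
    · rw [List.getElem?_append_right (by omega), List.getElem?_append_right (by omega)]
      obtain ⟨m, hm⟩ : ∃ m, j - l.length = m + 1 + 1 := ⟨j - l.length - 2, by omega⟩
      simp [hm]

/-- The factor by which the region color changes from left to right across string number `j`. -/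
def letter (k : Fin (D.len + 1)) (j : ℕ) : As X :=
  if h : j < (D.row k).length then
    if D.down ⟨k, ⟨j, h⟩⟩ then gen (C.1 (D.semiArc ⟨k, ⟨j, h⟩⟩))
    else (gen (C.1 (D.semiArc ⟨k, ⟨j, h⟩⟩)))⁻¹
  else 1

/-- The color of gap number `g`, read off along the row from the left. -/
def gapColor (k : Fin (D.len + 1)) : ℕ → As X
  | 0 => 1
  | g + 1 => gapColor k g * letter C k g

theorem letter_pass (k : Fin D.len) {i j : ℕ} (h : (D.slice k).StringPass i j) :
    letter C k.castSucc i = letter C k.succ j := by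
  have he := (D.fits k).getElem?_pass h
  unfold letter
  by_cases hi : i < (D.row k.castSucc).length
  · have hj : j < (D.row k.succ).length := by
      by_contra hj
      rw [List.getElem?_eq_getElem hi, List.getElem?_eq_none (by omega)] at he
      cases he
    rw [List.getElem?_eq_getElem hi, List.getElem?_eq_getElem hj] at he
    have hd : D.down ⟨k.castSucc, ⟨i, hi⟩⟩ = D.down ⟨k.succ, ⟨j, hj⟩⟩ := Option.some.inj he
    have hc : D.semiArc ⟨k.castSucc, ⟨i, hi⟩⟩ = D.semiArc ⟨k.succ, ⟨j, hj⟩⟩ :=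
      Quot.sound (.pass k _ _ h)
    rw [dif_pos hi, dif_pos hj, hd, hc]
  · have hj : ¬ j < (D.row k.succ).length := by
      intro hj
      rw [List.getElem?_eq_getElem hj, List.getElem?_eq_none (by omega)] at he
      cases he
    rw [dif_neg hi, dif_neg hj]

theorem letter_bend (k : Fin (D.len + 1)) {i : ℕ} {ε : Bool} (hi : i + 1 < (D.row k).length)
    (h0 : (D.row k)[i]? = some ε) (h1 : (D.row k)[i + 1]? = some (!ε))
    (hc : D.semiArc ⟨k, ⟨i, by omega⟩⟩ = D.semiArc ⟨k, ⟨i + 1, hi⟩⟩) :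
    letter C k i * letter C k (i + 1) = 1 := by
  rw [List.getElem?_eq_getElem (by omega)] at h0 h1
  have d0 : D.down ⟨k, ⟨i, by omega⟩⟩ = ε := Option.some.inj h0
  have d1 : D.down ⟨k, ⟨i + 1, hi⟩⟩ = !ε := Option.some.inj h1
  unfold letter
  rw [dif_pos hi, dif_pos (by omega), d0, d1, hc]
  cases ε <;> simp

theorem letter_cross (k : Fin D.len) {b : Bool} (hk : (D.slice k).kind = .cross b) :
    letter C k.castSucc (D.slice k).pos * letter C k.castSucc ((D.slice k).pos + 1) =
      letter C k.succ (D.slice k).pos * letter C k.succ ((D.slice k).pos + 1) := by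
  let c : D.Crossing := ⟨(k, b), hk⟩
  have hrow := D.crossing_row c
  have hC := C.2 c
  have hd : D.down c.nw = D.down c.se ∧ D.down c.ne = D.down c.sw := by
    obtain ⟨l, r, hl, h⟩ := D.fits k
    rw [hk] at h
    obtain ⟨ε, δ, h1, h2⟩ := h
    have e0 : (D.row k.castSucc)[(D.slice k).pos]? = some ε := by rw [h1, ← hl]; simp
    have e1 : (D.row k.castSucc)[(D.slice k).pos + 1]? = some δ := by rw [h1, ← hl]; simp
    have e2 : (D.row k.succ)[(D.slice k).pos]? = some δ := by rw [h2, ← hl]; simp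
    have e3 : (D.row k.succ)[(D.slice k).pos + 1]? = some ε := by rw [h2, ← hl]; simp
    obtain ⟨hr0, hr1⟩ := hrow
    have hr0' : (D.slice k).pos + 1 < (D.row k.castSucc).length := hr0
    have hr1' : (D.slice k).pos + 1 < (D.row k.succ).length := hr1
    rw [List.getElem?_eq_getElem (by omega)] at e0 e1 e2 e3
    exact ⟨(Option.some.inj e0).trans (Option.some.inj e3).symm,
      (Option.some.inj e1).trans (Option.some.inj e2).symm⟩
  have l0 : letter C k.castSucc (D.slice k).pos =
      if D.down c.nw then gen (C.1 (D.semiArc c.nw)) else (gen (C.1 (D.semiArc c.nw)))⁻¹ :=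
    dif_pos (Nat.lt_of_succ_lt hrow.1)
  have l1 : letter C k.castSucc ((D.slice k).pos + 1) =
      if D.down c.ne then gen (C.1 (D.semiArc c.ne)) else (gen (C.1 (D.semiArc c.ne)))⁻¹ :=
    dif_pos hrow.1
  have l2 : letter C k.succ (D.slice k).pos =
      if D.down c.sw then gen (C.1 (D.semiArc c.sw)) else (gen (C.1 (D.semiArc c.sw)))⁻¹ :=
    dif_pos (Nat.lt_of_succ_lt hrow.2)
  have l3 : letter C k.succ ((D.slice k).pos + 1) =
      if D.down c.se then gen (C.1 (D.semiArc c.se)) else (gen (C.1 (D.semiArc c.se)))⁻¹ :=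
    dif_pos hrow.2
  rw [l0, l1, l2, l3, ← hd.1, ← hd.2]
  rw [Crossing.ends, crossingEnds_map] at hC
  exact hC.letters

theorem gapColor_pass (k : Fin D.len) {g h : ℕ} (hgh : (D.slice k).GapPass g h) :
    gapColor C k.castSucc g = gapColor C k.succ h := by
  have left : ∀ g ≤ (D.slice k).pos, gapColor C k.castSucc g = gapColor C k.succ g := by
    intro g hg
    induction g with
    | zero => rfl
    | succ g ih =>
      rw [gapColor, gapColor, ih (by omega), letter_pass C k (i := g) (j := g)]
      unfold Slice.StringPass
      split <;> omega
  have hleft := left _ le_rfl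
  obtain ⟨l, r, hl, hf⟩ := D.fits k
  unfold Slice.GapPass at hgh
  split at hf
  · rename_i hk
    simp only [hk] at hgh
    obtain ⟨ε, -, hf⟩ := hf
    have hlen : (D.slice k).pos + 1 < (D.row k.succ).length := by
      rw [hf]; simp only [List.length_append, List.length_cons]; omega
    have hb := letter_bend C k.succ (i := (D.slice k).pos) (ε := ε) hlen
      (by rw [hf, ← hl]; simp) (by rw [hf, ← hl]; simp) (Quot.sound (.max k _ _ hk rfl rfl))
    have right : ∀ n, gapColor C k.castSucc ((D.slice k).pos + n) =
        gapColor C k.succ ((D.slice k).pos + n + 2) := by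
      intro n
      induction n with
      | zero =>
        show _ = gapColor C k.succ _ * _ * _
        rw [mul_assoc]
        simpa only [Nat.add_zero, hb, mul_one] using hleft
      | succ n ih =>
        show gapColor C _ ((D.slice k).pos + n) * letter C _ ((D.slice k).pos + n) =
          gapColor C _ ((D.slice k).pos + n + 2) * letter C _ ((D.slice k).pos + n + 2)
        rw [ih, letter_pass C k (i := (D.slice k).pos + n) (j := (D.slice k).pos + n + 2)]
        unfold Slice.StringPass
        rw [hk]
        exact Or.inr ⟨by omega, rfl⟩
    rcases hgh with ⟨h1, rfl⟩ | ⟨h1, rfl⟩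
    · exact left _ h1
    · obtain ⟨n, rfl⟩ := Nat.exists_eq_add_of_le h1
      exact right n
  · rename_i hk
    simp only [hk] at hgh
    obtain ⟨ε, hf, -⟩ := hf
    have hlen : (D.slice k).pos + 1 < (D.row k.castSucc).length := by
      rw [hf]; simp only [List.length_append, List.length_cons]; omega
    have hb := letter_bend C k.castSucc (i := (D.slice k).pos) (ε := ε) hlen
      (by rw [hf, ← hl]; simp) (by rw [hf, ← hl]; simp) (Quot.sound (.min k _ _ hk rfl rfl))
    have right : ∀ n, gapColor C k.castSucc ((D.slice k).pos + n + 2) =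
        gapColor C k.succ ((D.slice k).pos + n) := by
      intro n
      induction n with
      | zero =>
        show gapColor C k.castSucc _ * _ * _ = _
        rw [mul_assoc]
        simpa only [Nat.add_zero, hb, mul_one] using hleft
      | succ n ih =>
        show gapColor C _ ((D.slice k).pos + n + 2) * letter C _ ((D.slice k).pos + n + 2) =
          gapColor C _ ((D.slice k).pos + n) * letter C _ ((D.slice k).pos + n)
        rw [ih,
          letter_pass C k (i := (D.slice k).pos + n + 2) (j := (D.slice k).pos + n)]
        unfold Slice.StringPass
        rw [hk]
        exact Or.inr ⟨by omega, rfl⟩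
    rcases hgh with ⟨h1, rfl⟩ | ⟨h1, rfl⟩
    · exact left _ h1
    · obtain ⟨n, rfl⟩ := Nat.exists_eq_add_of_le h1
      exact right n
  · rename_i b hk
    simp only [hk] at hgh
    have hb := letter_cross C k hk
    have right : ∀ n, gapColor C k.castSucc ((D.slice k).pos + 2 + n) =
        gapColor C k.succ ((D.slice k).pos + 2 + n) := by
      intro n
      induction n with
      | zero =>
        show gapColor C k.castSucc _ * _ * _ = gapColor C k.succ _ * _ * _
        rw [mul_assoc, mul_assoc, hb, hleft]
      | succ n ih =>
        show gapColor C _ ((D.slice k).pos + 2 + n) * letter C _ ((D.slice k).pos + 2 + n) =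
          gapColor C _ ((D.slice k).pos + 2 + n) * letter C _ ((D.slice k).pos + 2 + n)
        rw [ih,
          letter_pass C k (i := (D.slice k).pos + 2 + n) (j := (D.slice k).pos + 2 + n)]
        unfold Slice.StringPass
        rw [hk]
        exact ⟨Or.inr (by omega), rfl⟩
    obtain ⟨h1, rfl⟩ := hgh
    rcases Nat.lt_or_ge (D.slice k).pos h with h2 | h2
    · obtain ⟨n, rfl⟩ := Nat.exists_eq_add_of_le (show (D.slice k).pos + 2 ≤ h by omega)
      exact right n
    · exact left _ h2

theorem gapColor_cross (s : D.Piece) :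
    gapColor C s.1 (D.source s).2 * gen (C.1 (D.semiArc s)) = gapColor C s.1 (D.target s).2 := by
  obtain ⟨k, i⟩ := s
  have hl : letter C k i = if D.down ⟨k, i⟩ then gen (C.1 (D.semiArc ⟨k, i⟩))
    else (gen (C.1 (D.semiArc ⟨k, i⟩)))⁻¹ := dif_pos i.2
  have hg : gapColor C k ((i : ℕ) + 1) = gapColor C k i * letter C k i := rfl
  rw [hl] at hg
  cases hd : D.down ⟨k, i⟩ <;> simp [source, target, hd] at hg ⊢ <;> simp [hg]

/-- Every biquandle coloring has exactly one region coloring. -/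
theorem existsUnique_regionColoring : ∃! R : D.Region → As X, IsRegionColoring C R := by
  refine ⟨Quot.lift (fun g => gapColor C g.1 g.2) ?_, ⟨rfl, fun s => gapColor_cross C s⟩, ?_⟩
  · rintro _ _ ⟨k, g, h, hgh⟩
    exact gapColor_pass C k hgh
  · intro R hR
    have h0 : ∀ k : Fin (D.len + 1), R (D.region ⟨k, 0⟩) = 1 := by
      intro k
      induction k using Fin.induction with
      | zero => exact hR.unbounded
      | succ k ih =>
        rw [← ih]
        refine congrArg R (Quot.sound (.pass k 0 0 ?_)).symm
        unfold Slice.GapPass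
        split <;> simp
    have h1 : ∀ (k : Fin (D.len + 1)) (g : ℕ) (hg : g < (D.row k).length + 1),
        R (D.region ⟨k, ⟨g, hg⟩⟩) = gapColor C k g := by
      intro k g
      induction g with
      | zero => exact fun _ => h0 k
      | succ g ih =>
        intro hg
        have hs := hR.cross ⟨k, ⟨g, by omega⟩⟩
        have ht := gapColor_cross C ⟨k, ⟨g, by omega⟩⟩
        have ih' := ih (by omega)
        unfold source target at hs ht
        cases hd : D.down ⟨k, ⟨g, by omega⟩⟩
        · simp only [hd, Bool.false_eq_true, if_false] at hs ht
          exact mul_right_cancel ((hs.trans ih').trans ht.symm)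
        · simp only [hd, if_true] at hs ht
          exact hs.symm.trans ((congrArg (· * _) ih').trans ht)
    funext r
    obtain ⟨⟨k, g⟩, rfl⟩ := Quot.exists_rep r
    exact h1 k g g.2

/-- The region coloring with respect to a biquandle coloring. -/
noncomputable def regionColoring : D.Region → As X := (existsUnique_regionColoring C).exists.choose

theorem regionColoring_spec : IsRegionColoring C (regionColoring C) :=
  (existsUnique_regionColoring C).exists.choose_spec

end RegionColoring

/-! ### Pulling away the doubled strings

Replace `D` by its double: behind every string a copy with the opposite orientation is put, pushed
slightly in the direction of the normal vector. In a row of vertical strings, first the copy of the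
leftmost string is moved to the far right, then the copy of the second string to the place on the
left of that one, and so on; the copies stay behind all other strings that they meet. This leaves
the original strings on the left and the copies, in reverse order, on the right. -/

/-- The coloring of the double of a row that is induced by a quandle coloring: a string and its
copy both get the color of the arc. -/
def doubledRow {X : Type u} [Biquandle X] (C : D.QuandleColoring (Qdl X)) (k : Fin (D.len + 1)) :
    List (Bool × X) :=
  (List.finRange (D.row k).length).flatMap fun i =>
    let s : D.Piece := ⟨k, i⟩
    let a : X := (C.1 (D.toArc (D.semiArc s))).val
    if D.down s then [(D.down s, a), (!D.down s, a)] else [(!D.down s, a), (D.down s, a)]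

/-- The colored row of strings of `D` given by a biquandle coloring. -/
def coloredRow {X : Type u} [Biquandle X] (C : D.BiquandleColoring X) (k : Fin (D.len + 1)) :
    List (Bool × X) :=
  List.ofFn fun i : Fin (D.row k).length => (D.down ⟨k, i⟩, C.1 (D.semiArc ⟨k, i⟩))

/-- The positions, from top to bottom, of the crossings that pull away the copies from the double
of a row with orientations `ε`. In step `j`, the copy of string number `j` starts at position
`j + 1` or `j` and ends at position `2 * n - 1 - j`, where `n` is the number of strings. -/
def pullAwayWord (ε : List Bool) : List ℕ :=
  (List.finRange ε.length).flatMap fun (j : Fin ε.length) =>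
    let start : ℕ := (j : ℕ) + if ε.get j then 1 else 0
    List.range' start (2 * ε.length - 1 - (j : ℕ) - start)

/-- `BraidColoring w t b`: the tangle without maxima and minima that has its crossings at the
positions `w`, at each of which the string from the upper left to the lower right goes under, has a
biquandle coloring with the oriented and colored row `t` at the top and `b` at the bottom. -/
inductive BraidColoring {X : Type u} [Biquandle X] :
    List ℕ → List (Bool × X) → List (Bool × X) → Prop
  | nil (t : List (Bool × X)) : BraidColoring [] t t
  | cons (l r : List (Bool × X)) (ε δ : Bool) (nw ne sw se : X) (w : List ℕ)
      (b : List (Bool × X)) (rule : ColorRule (crossingEnds false ε δ nw ne sw se))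
      (h : BraidColoring w (l ++ (δ, sw) :: (ε, se) :: r) b) :
      BraidColoring (l.length :: w) (l ++ (ε, nw) :: (δ, ne) :: r) b

/-- `IsPullAway C C'`: the biquandle coloring `C'` is what is left on the strings of `D` when the
double of `D`, with the coloring induced by `C`, has its copies pulled away. -/
def IsPullAway {X : Type u} [Biquandle X] (C : D.QuandleColoring (Qdl X))
    (C' : D.BiquandleColoring X) : Prop :=
  ∀ k : Fin (D.len + 1), ∃ copies : List (Bool × X),
    BraidColoring (pullAwayWord (D.row k)) (doubledRow C k) (coloredRow C' k ++ copies)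

/-! ### Cocycle invariants -/

section Invariants

variable {A : Type v} [AddCommGroup A]

/-- The weight of a crossing for a biquandle coloring: the sign times `θ (x, y)`, where `x` and `y`
are the colors of the halves of the under-string and the over-string that bound the specified
region. -/
def Crossing.biquandleWeight {X : Type u} [Biquandle X] (θ : X × X → A)
    (C : D.BiquandleColoring X) (c : D.Crossing) : A :=
  c.sign • θ (C.1 c.ends.i, C.1 c.ends.j)

/-- The weight of a crossing for a quandle coloring: the sign times `θ (p, a, b)`, where `p` is the
color of the specified region, and `a` and `b` are the colors of the arcs of the under-string and
the over-string that bound this region. -/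
noncomputable def Crossing.shadowWeight {Q : Type u} [Quandle Q] (θ : As Q × Q × Q → A)
    (C : D.QuandleColoring Q) (c : D.Crossing) : A :=
  c.sign • θ (regionColoring C.toBiquandle c.specified,
    C.1 (D.toArc c.ends.i), C.1 (D.toArc c.ends.j))

variable (D)

/-- The biquandle cocycle invariant, as a map on the set of colorings. -/
noncomputable def biquandleInvariant {X : Type u} [Biquandle X] (θ : X × X → A)
    (C : D.BiquandleColoring X) : A :=
  ∑ c : D.Crossing, c.biquandleWeight θ C

/-- The shadow quandle cocycle invariant, as a map on the set of colorings. -/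
noncomputable def shadowInvariant {Q : Type u} [Quandle Q] (θ : As Q × Q × Q → A)
    (C : D.QuandleColoring Q) : A :=
  ∑ c : D.Crossing, c.shadowWeight θ C

/-- The biquandle cocycle invariant in the group ring `ℤ[A]`, for a finite biquandle (then there
are only finitely many colorings). -/
noncomputable def biquandleInvariantSum {X : Type u} [Biquandle X] [Finite X] (θ : X × X → A) :
    AddMonoidAlgebra ℤ A :=
  ∑ᶠ C : D.BiquandleColoring X, AddMonoidAlgebra.single (D.biquandleInvariant θ C) 1

/-- The shadow quandle cocycle invariant in the group ring `ℤ[A]`, for a finite quandle. -/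
noncomputable def shadowInvariantSum {Q : Type u} [Quandle Q] [Finite Q]
    (θ : As Q × Q × Q → A) : AddMonoidAlgebra ℤ A :=
  ∑ᶠ C : D.QuandleColoring Q, AddMonoidAlgebra.single (D.shadowInvariant θ C) 1

end Invariants

end LinkDiagram

end BiquandleLink

open BiquandleLink

namespace BiquandleLink

universe u v

open Biquandle

/-! ### The map `ψ` and the action of `As(X)` on `As(Q(X))` -/

section PsiAction

variable {X : Type u} [Biquandle X]

/-! The bijection has a closed form, `toBiquandleColoring`: a semi-arc of quandle color `a` gets the
color `psi p a`, where `p` is the color in `As(Q(X))` of the region from which its normal points.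
Let the specified region of a crossing have color `p`, and let `a`, `b` be the quandle colors of the
ends `i`, `j`. The source regions of the ends `k`, `l` then have the colors `p * gen b` and `p * gen
a`, and `psi_mul_gen_act` and `psi_mul_gen` are exactly the biquandle rule. The ends `i` and `j`
both have the specified region as source, so the weights agree crossing by crossing. The same
identities turn the shadow cocycle condition at `p, a₁, a₂, a₃` into the biquandle cocycle condition
at the three values `psi p aᵢ`.

For bijectivity, each `psi p` is a bijection, so an element `x` of `X` can move `p` to `p * gen a`
with `psi p a = x` (`asStep`). These permutations satisfy the relations of `As(X)` and give a right
action of `As(X)` on the set `As(Q(X))`. Applied to the unit element, the `As(X)`-region colors of a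
biquandle coloring yield the `As(Q(X))`-region colors; inverting `psi` there yields the quandle
colors.

The closed form describes the pulling away by induction along a row (`braidColoring_pulledRow`): if
`p` is the color of the region on the left, the strings that are still doubled carry the colors `psi
p a`. A copy that passes behind a pair keeps its own color and replaces `p` by the color of the next
region. Since colors at the top of a braid determine those at the bottom, no other result is
possible (`isPullAway_iff`). -/

theorem switch_injective {x y x' y' : X} (h1 : overOp y x = overOp y' x')
    (h2 : underOp x y = underOp x' y') : x = x' ∧ y = y' :=
  Prod.mk.inj (switch_bijective.1 (a₁ := (x, y)) (a₂ := (x', y')) (Prod.ext h1 h2))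

theorem overInv_kMap (x : X) : overInv x (kMap x) = kMap x :=
  over_right_cancel ((over_overInv _ _).trans (over_kMap _).symm)

theorem gen_mul_gen_act {Q : Type u} [Quandle Q] (a b : Q) :
    gen a * gen b = gen b * gen (Shelf.act b a) :=
  gen_mul_gen a b

/-- Built into the construction: `psi p` is a value of the action on endomorphisms of `Q(X)`. -/
theorem psi_act (p : As (Qdl X)) (a b : Qdl X) :
    psi p (Shelf.act b a) = derived (psi p a) (psi p b) :=
  ((psiHom p).unop ⟨id, fun _ _ => rfl⟩).2 a.val b.val

/-- The source of the rule for under-strings: `psi p` preserves the derived operation, and the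
overlined product by `psi p b` cancels the inverse in its definition. -/
theorem psi_mul_gen_act (p : As (Qdl X)) (a b : Qdl X) :
    psi (p * gen b) (Shelf.act b a) = underOp (psi p a) (psi p b) := by
  rw [psi_mul_gen, psi_act, over_derived]

/-- The color of a string oriented upward with `p` on its left: its normal starts on the right,
where the region color is `p * (gen a)⁻¹`. -/
theorem psi_mul_gen_inv_self (p : As (Qdl X)) (a : Qdl X) :
    psi (p * (gen a)⁻¹) a = kMap (psi p a) := by
  rw [psi_mul_gen_inv, overInv_kMap]

/-- Induction on a word for `p`: each further letter composes `psi p` with some `overPerm` or its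
inverse. -/
theorem psi_bijective (p : As (Qdl X)) : Bijective (psi p) := by
  have h : p ∈ Subgroup.closure (Set.range (gen : Qdl X → As (Qdl X))) := by
    rw [show Set.range (gen : Qdl X → As (Qdl X)) = Set.range PresentedGroup.of from rfl,
      PresentedGroup.closure_range_of]
    exact Subgroup.mem_top p
  induction h using Subgroup.closure_induction_right with
  | one =>
    have : psi (1 : As (Qdl X)) = Qdl.val := funext psi_one
    rw [this]
    exact ⟨fun _ _ => Qdl.ext, fun x => ⟨⟨x⟩, rfl⟩⟩
  | mul_right p _ y hy ih =>
    obtain ⟨b, rfl⟩ := hy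
    rw [show psi (p * gen b) = overPerm (psi p b) ∘ psi p from
      funext fun a => psi_mul_gen p a b]
    exact (overPerm _).bijective.comp ih
  | mul_inv_cancel p _ y hy ih =>
    obtain ⟨b, rfl⟩ := hy
    rw [show psi (p * (gen b)⁻¹) = (overPerm (kMap (psi p b))).symm ∘ psi p from
      funext fun a => psi_mul_gen_inv p a b]
    exact (overPerm _).symm.bijective.comp ih

/-- The inverse of the bijection `psi p`. -/
noncomputable def psiInv (p : As (Qdl X)) (x : X) : Qdl X :=
  (Equiv.ofBijective _ (psi_bijective p)).symm x

theorem psi_psiInv (p : As (Qdl X)) (x : X) : psi p (psiInv p x) = x :=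
  (Equiv.ofBijective _ (psi_bijective p)).apply_symm_apply x

theorem psiInv_psi (p : As (Qdl X)) (a : Qdl X) : psiInv p (psi p a) = a :=
  (Equiv.ofBijective _ (psi_bijective p)).symm_apply_apply a

/-! ### The right action of `As(X)` on the set `As(Q(X))` -/

/-- The permutation `p ↦ p * a` of `As(Q(X))`, where `psi p a = x`. -/
noncomputable def asStep (x : X) : Equiv.Perm (As (Qdl X)) where
  toFun p := p * gen (psiInv p x)
  -- If `q = p * gen a` with `psi p a = x`, then `psi q a = overOp x x`; hence `a` can be read off
  -- from `q` and `x`.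
  invFun q := q * (gen (psiInv q (overOp x x)))⁻¹
  left_inv p := by
    have h : psi (p * gen (psiInv p x)) (psiInv p x) = overOp x x := by
      rw [psi_mul_gen, psi_psiInv]
    beta_reduce
    rw [← h, psiInv_psi, mul_inv_cancel_right]
  right_inv q := by
    have h : psi (q * (gen (psiInv q (overOp x x)))⁻¹) (psiInv q (overOp x x)) = x := by
      rw [psi_mul_gen_inv_self, psi_psiInv, kMap_over]
    beta_reduce
    generalize psiInv q (overOp x x) = a at h ⊢
    rw [← h, psiInv_psi, inv_mul_cancel_right]

theorem asStep_apply (x : X) (p : As (Qdl X)) : asStep x p = p * gen (psiInv p x) := rfl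

theorem asStep_psi (p : As (Qdl X)) (a : Qdl X) : asStep (psi p a) p = p * gen a := by
  rw [asStep_apply, psiInv_psi]

/-- The right action of `As(X)` on `As(Q(X))` in which `x` acts by `asStep x`. -/
noncomputable def asAction : As X →* (Equiv.Perm (As (Qdl X)))ᵐᵒᵖ :=
  PresentedGroup.toGroup (f := fun x : X => MulOpposite.op (asStep x)) (by
    rintro r ⟨x, y, rfl⟩
    rw [map_mul, map_inv, mul_inv_eq_one, map_mul, map_mul]
    simp only [FreeGroup.lift_apply_of]
    rw [← MulOpposite.op_mul, ← MulOpposite.op_mul]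
    congr 1
    ext p
    -- With `x = psi p a` and `y = psi p b`, the two sides of the relation move `p` to `p * gen a *
    -- gen b` and to `p * gen b * gen (Shelf.act b a)`.
    obtain ⟨a, rfl⟩ := (psi_bijective p).2 x
    obtain ⟨b, rfl⟩ := (psi_bijective p).2 y
    rw [Equiv.Perm.mul_apply, Equiv.Perm.mul_apply, asStep_psi, asStep_psi, ← psi_mul_gen,
      ← psi_mul_gen_act, asStep_psi, asStep_psi, mul_assoc, mul_assoc, gen_mul_gen_act])

/-- The orbit map of the unit element under `asAction`. -/
noncomputable def asOrbit (g : As X) : As (Qdl X) := (asAction g).unop 1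

theorem asOrbit_one : asOrbit (1 : As X) = 1 := by
  simp only [asOrbit, map_one]
  rfl

/-- The opposite group makes the last letter of a word act last. `asOrbit` is an orbit map, with no
claim of being multiplicative. -/
theorem asOrbit_mul_gen (g : As X) (x : X) : asOrbit (g * gen x) = asStep x (asOrbit g) := by
  have h : asAction (gen x) = MulOpposite.op (asStep x) := PresentedGroup.toGroup.of _
  simp only [asOrbit, map_mul, h]
  rfl

/-- After rewriting, every term is a value of `θ` at products of the elements `psi p aᵢ`: passing to
`p * gen aᵢ` gives an overlined product, and acting by `aᵢ` as well gives an underlined one. -/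
theorem isShadowCocycle_pullback {A : Type v} [AddCommGroup A] {θ : X × X → A}
    (hθ : IsBiquandleCocycle θ) : IsShadowCocycle (pullback θ) where
  cocycle p a₁ a₂ a₃ := by
    simp only [pullback, psi_mul_gen, psi_act, derived_over, over_derived]
    exact hθ.cocycle _ _ _
  degenerate p b := hθ.degenerate _

end PsiAction

/-! ### Pulling away the copies of a row -/

section PullAway

variable {X : Type u} [Biquandle X]

/-- The colors at the top of a crossing determine those at the bottom. -/
theorem ColorRule.bottom_unique {ε δ : Bool} {nw ne sw se sw' se' : X}
    (h : ColorRule (crossingEnds false ε δ nw ne sw se))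
    (h' : ColorRule (crossingEnds false ε δ nw ne sw' se')) : sw = sw' ∧ se = se' := by
  obtain ⟨h1, h2⟩ := h
  obtain ⟨h3, h4⟩ := h'
  -- Each orientation needs its own axiom: for two upward strings bijectivity of the underlined
  -- product, for up and down none, for down and up injectivity of the switch, for two downward
  -- strings bijectivity of the overlined product.
  cases ε <;> cases δ <;>
    simp only [crossingEnds, if_true, if_false, Bool.false_eq_true] at h1 h2 h3 h4
  · obtain rfl := (under_bijective ne).1 (h1.trans h3.symm)
    exact ⟨h2.symm.trans h4, rfl⟩
  · exact ⟨h2.symm.trans h4, h1.symm.trans h3⟩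
  · exact (switch_injective (h2.trans h4.symm) (h1.trans h3.symm)).symm
  · obtain rfl := over_right_cancel (h2.trans h4.symm)
    exact ⟨rfl, h1.symm.trans h3⟩

namespace LinkDiagram.BraidColoring

open LinkDiagram

/-- Equations for the position and the top row make the inversion applicable when the top row is
already written as a concatenation. -/
theorem cons_inv {m : ℕ} {w : List ℕ} {t b : List (Bool × X)} (h : BraidColoring (m :: w) t b) :
    ∃ (l r : List (Bool × X)) (ε δ : Bool) (nw ne sw se : X), l.length = m ∧
      t = l ++ (ε, nw) :: (δ, ne) :: r ∧ ColorRule (crossingEnds false ε δ nw ne sw se) ∧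
      BraidColoring w (l ++ (δ, sw) :: (ε, se) :: r) b := by
  cases h with
  | cons l r ε δ nw ne sw se w b rule h =>
    exact ⟨l, r, ε, δ, nw, ne, sw, se, rfl, rfl, rule, h⟩

/-- The colors at the top of a tangle determine those at the bottom. -/
theorem bottom_unique {w : List ℕ} {t b b' : List (Bool × X)} (h : BraidColoring w t b)
    (h' : BraidColoring w t b') : b = b' := by
  induction h with
  | nil t => cases h'; rfl
  | cons l r ε δ nw ne sw se w b rule h ih =>
    obtain ⟨l', r', ε', δ', nw', ne', sw', se', hl, ht, rule', h'⟩ := h'.cons_inv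
    obtain ⟨rfl, ht'⟩ := List.append_inj ht hl.symm
    simp only [List.cons.injEq, Prod.mk.injEq] at ht'
    obtain ⟨⟨rfl, rfl⟩, ⟨rfl, rfl⟩, rfl⟩ := ht'
    obtain ⟨rfl, rfl⟩ := rule.bottom_unique rule'
    exact ih h'

theorem append {w w' : List ℕ} {t m b : List (Bool × X)} (h : BraidColoring w t m)
    (h' : BraidColoring w' m b) : BraidColoring (w ++ w') t b := by
  induction h with
  | nil t => exact h'
  | cons l r ε δ nw ne sw se w b rule h ih => exact cons l r ε δ nw ne sw se _ _ rule (ih h')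

end LinkDiagram.BraidColoring

open LinkDiagram

/-- The row of doubled strings in which the strings of both orientations have the colors `c`. -/
def pairRow {Y : Type*} (c : List Y) : List (Bool × Y) := c.flatMap fun x => [(true, x), (false, x)]

theorem pairRow_cons {Y : Type*} (x : Y) (c : List Y) :
    pairRow (x :: c) = (true, x) :: (false, x) :: pairRow c := rfl

/-- A string of color `x` passes behind a row of doubled strings. -/
theorem braidColoring_pairRow (ε : Bool) (x : X) (f : X → X)
    (hf : ∀ y, if ε then overOp (f y) x = y else f y = overOp y x) (c : List X)
    (l r : List (Bool × X)) :
    BraidColoring (List.range' l.length (2 * c.length)) (l ++ (ε, x) :: (pairRow c ++ r))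
      (l ++ pairRow (c.map f) ++ (ε, x) :: r) := by
  induction c generalizing l with
  | nil =>
    simpa [pairRow] using BraidColoring.nil (l ++ (ε, x) :: r)
  | cons y c ih =>
    have ih := ih (l ++ [(true, f y), (false, f y)])
    have hy := hf y
    rw [List.length_cons, show 2 * (c.length + 1) = 2 * c.length + 1 + 1 by ring,
      List.range'_succ, List.range'_succ]
    -- `z` is the color of the moving string between the two strings of a pair. These have equal
    -- colors and opposite orientations, so the second crossing undoes the first and the moving
    -- string leaves with the color `x`.
    have step : ∃ z, ColorRule (crossingEnds false ε true x y (f y) z) ∧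
        ColorRule (crossingEnds false ε false z y (f y) x) := by
      cases ε
      · exact ⟨underOp x y, ⟨rfl, hy.symm⟩, rfl, hy.symm⟩
      · exact ⟨underOp x (f y), ⟨rfl, hy⟩, rfl, hy⟩
    obtain ⟨z, h1, h2⟩ := step
    refine .cons l ((false, y) :: (pairRow c ++ r)) ε true x y (f y) z _ _ h1 ?_
    have := BraidColoring.cons (l ++ [(true, f y)]) (pairRow c ++ r) ε false z y (f y) x
      (List.range' (l.length + 1 + 1) (2 * c.length)) (l ++ pairRow ((y :: c).map f) ++ (ε, x) :: r)
      h2 (by simpa [pairRow_cons] using ih)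
    simpa using this

/-- The positions of the crossings that pull away the copies of strings with orientations `ε`, if
there are `m` strings on their left. -/
def pullAwayWordFrom : ℕ → List Bool → List ℕ
  | _, [] => []
  | m, ε :: w => List.range' (m + if ε then 1 else 0) (2 * w.length + 1 - if ε then 1 else 0) ++
      pullAwayWordFrom (m + 1) w

/-- The shift by `m`, with `m + ε.length` as total number of strings, makes the closed formula for
the positions accessible to induction on the row. -/
theorem pullAwayWordFrom_eq (m : ℕ) (ε : List Bool) :
    ((List.finRange ε.length).flatMap fun (j : Fin ε.length) =>
      List.range' (m + j + if ε.get j then 1 else 0)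
        (2 * (m + ε.length) - 1 - (m + j) - (m + j + if ε.get j then 1 else 0))) =
      pullAwayWordFrom m ε := by
  induction ε generalizing m with
  | nil => rfl
  | cons b ε ih =>
    rw [pullAwayWordFrom, ← ih]
    change (List.finRange (ε.length + 1)).flatMap _ = _
    rw [List.finRange_succ, List.flatMap_cons, List.flatMap_map]
    congr 1
    · simp only [List.get_eq_getElem, Fin.val_zero, List.getElem_cons_zero]
      congr 1
      cases b <;> simp <;> omega
    · congr 1
      funext j
      simp only [List.get_eq_getElem, Fin.val_succ, List.getElem_cons_succ, List.length_cons]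
      congr 1 <;> omega

theorem pullAwayWord_eq (ε : List Bool) : pullAwayWord ε = pullAwayWordFrom 0 ε := by
  rw [← pullAwayWordFrom_eq]
  simp [pullAwayWord]

/-- The factor by which the region color changes from left to right across a string. -/
def signedGen {Y : Type u} [Biquandle Y] (s : Bool × Y) : As Y :=
  if s.1 then gen s.2 else (gen s.2)⁻¹

/-- The row that is left after pulling away the copies of strings with given orientations and
quandle colors, if the region on their left has the color `p`. -/
noncomputable def pulledRow : As (Qdl X) → List (Bool × Qdl X) → List (Bool × X)
  | _, [] => []
  | p, s :: w =>
    (s.1, psi (if s.1 then p else p * signedGen s) s.2) :: pulledRow (p * signedGen s) w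

/-- The invariant of the process: `l` holds the strings already freed, `r` the copies already pulled
away, and the pairs between them carry the colors `psi p a`, where `p` is the color of the region to
the left of the pairs. -/
theorem braidColoring_pulledRow (p : As (Qdl X)) (w : List (Bool × Qdl X))
    (l r : List (Bool × X)) : ∃ copies : List (Bool × X),
    BraidColoring (pullAwayWordFrom l.length (w.map Prod.fst))
      (l ++ (pairRow (w.map fun s => psi p s.2) ++ r)) (l ++ (pulledRow p w ++ copies)) := by
  induction w generalizing p l r with
  | nil => exact ⟨r, .nil _⟩
  | cons s w ih =>
    obtain ⟨ε, a⟩ := s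
    -- The final color of the string, taken at the region from which its normal points; its copy
    -- travels to the right with the same color.
    let y := psi (if ε then p else p * signedGen (ε, a)) a
    obtain ⟨copies, h⟩ := ih (p * signedGen (ε, a)) (l ++ [(ε, y)]) ((!ε, y) :: r)
    refine ⟨copies, ?_⟩
    have h : BraidColoring (pullAwayWordFrom (l.length + 1) (w.map Prod.fst))
        (l ++ (ε, y) :: (pairRow (w.map fun s => psi (p * signedGen (ε, a)) s.2) ++ (!ε, y) :: r))
        (l ++ (pulledRow p ((ε, a) :: w) ++ copies)) := by
      simpa [pulledRow, y] using h
    refine BraidColoring.append ?_ h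
    cases ε
    -- An upward string has its copy on the left, so the copy first passes behind its own string.
    -- This changes both colors from `psi p a` to `y` with `overOp y y = psi p a`, which is why
    -- `kMap` enters.
    · have hy : y = kMap (psi p a) := psi_mul_gen_inv_self p a
      have := braidColoring_pairRow true y (fun x => overInv x y)
        (fun x => by simp [over_overInv]) (w.map fun s => psi p s.2) (l ++ [(false, y)]) r
      have e : (w.map fun s => psi p s.2).map (fun x => overInv x y) =
          w.map fun s => psi (p * signedGen (false, a)) s.2 := by
        simp [signedGen, psi_mul_gen_inv, hy]
      rw [e] at this
      simp only [Bool.false_eq_true, if_false, Nat.add_zero, Nat.sub_zero, List.length_map,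
        List.range'_succ, List.map_cons, pairRow_cons, List.cons_append]
      refine .cons l _ true false _ _ y y _ _ ?_ (by simpa using this)
      rw [hy]
      exact ⟨(under_self _).trans (over_kMap _), over_kMap _⟩
    -- A downward string has its copy on the right, so the copy never meets it and the color stays.
    · have hy : y = psi p a := rfl
      have := braidColoring_pairRow false y (fun x => overOp x y)
        (fun x => by simp) (w.map fun s => psi p s.2) (l ++ [(true, y)]) r
      have e : (w.map fun s => psi p s.2).map (fun x => overOp x y) =
          w.map fun s => psi (p * signedGen (true, a)) s.2 := by
        simp [signedGen, psi_mul_gen, hy]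
      rw [e] at this
      simpa [pairRow_cons, hy] using this

/-- Replaces the running product in `pulledRow` by any family `P` of gap colors with the same
increments, so that region colors can be inserted. -/
theorem pulledRow_ofFn {n : ℕ} (s : Fin n → Bool × Qdl X) (P : Fin (n + 1) → As (Qdl X))
    (hP : ∀ i, P i.succ = P i.castSucc * signedGen (s i)) :
    pulledRow (P 0) (List.ofFn s) =
      List.ofFn fun i => ((s i).1, psi (if (s i).1 then P i.castSucc else P i.succ) (s i).2) := by
  induction n with
  | zero => rfl
  | succ n ih =>
    have h0 : P 1 = P 0 * signedGen (s 0) := hP 0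
    have := ih (fun i => s i.succ) (fun i => P i.succ) (fun i => hP i.succ)
    rw [List.ofFn_succ, List.ofFn_succ, pulledRow, ← h0]
    exact congrArg _ this

end PullAway

namespace LinkDiagram

variable {D : LinkDiagram}

/-! ### The regions on the two sides of a semi-arc -/

/-- The two strings of a bend share the gap between them, and their outer gaps are connected around
the bend. Opposite orientations make sources match sources and targets match targets. -/
theorem bend_source_target (k : Fin (D.len + 1)) (i j : Fin (D.row k).length) {ε : Bool}
    (hij : (j : ℕ) = i + 1) (hi : (D.row k)[(i : ℕ)]? = some ε)
    (hj : (D.row k)[(j : ℕ)]? = some (!ε))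
    (outer : D.region ⟨k, i.castSucc⟩ = D.region ⟨k, j.succ⟩) :
    D.region (D.source ⟨k, i⟩) = D.region (D.source ⟨k, j⟩) ∧
      D.region (D.target ⟨k, i⟩) = D.region (D.target ⟨k, j⟩) := by
  rw [List.getElem?_eq_getElem i.2] at hi
  rw [List.getElem?_eq_getElem j.2] at hj
  have di : D.down ⟨k, i⟩ = ε := Option.some.inj hi
  have dj : D.down ⟨k, j⟩ = !ε := Option.some.inj hj
  have inner : D.region ⟨k, i.succ⟩ = D.region ⟨k, j.castSucc⟩ := by
    congr 2
    exact Fin.ext hij.symm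
  unfold source target
  rw [di, dj]
  cases ε
  · exact ⟨inner, outer⟩
  · exact ⟨outer, inner⟩

/-- This makes the two sides of a semi-arc well-defined regions. -/
theorem Joined.source_target {s t : D.Piece} (h : D.Joined s t) :
    D.region (D.source s) = D.region (D.source t) ∧
      D.region (D.target s) = D.region (D.target t) := by
  have key : ∀ (k : Fin D.len) (g h : ℕ) (hg hh) (_ : (D.slice k).GapPass g h),
      D.region ⟨k.castSucc, ⟨g, hg⟩⟩ = D.region ⟨k.succ, ⟨h, hh⟩⟩ :=
    fun k g h hg hh hgh => Quot.sound (.pass k _ _ hgh)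
  cases h with
  | pass k i j h =>
    have hd : D.down ⟨k.castSucc, i⟩ = D.down ⟨k.succ, j⟩ := by
      have := (D.fits k).getElem?_pass h
      rw [List.getElem?_eq_getElem i.2, List.getElem?_eq_getElem j.2] at this
      exact Option.some.inj this
    have gaps : (D.slice k).GapPass i j ∧ (D.slice k).GapPass (i + 1) (j + 1) := by
      unfold Slice.StringPass at h
      unfold Slice.GapPass
      cases hk : (D.slice k).kind <;> simp only [hk] at h ⊢ <;> omega
    have hl : D.region ⟨k.castSucc, i.castSucc⟩ = D.region ⟨k.succ, j.castSucc⟩ :=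
      key k i j _ _ gaps.1
    have hr : D.region ⟨k.castSucc, i.succ⟩ = D.region ⟨k.succ, j.succ⟩ :=
      key k (i + 1) (j + 1) _ _ gaps.2
    unfold source target
    rw [hd]
    cases D.down ⟨k.succ, j⟩
    · exact ⟨hr, hl⟩
    · exact ⟨hl, hr⟩
  | max k i j h hi hj =>
    obtain ⟨l, r, hl, hf⟩ := D.fits k
    simp only [h] at hf
    obtain ⟨ε, ht, hb⟩ := hf
    have hlen : (D.slice k).pos < (D.row k.castSucc).length + 1 := by
      rw [ht, List.length_append]; omega
    refine bend_source_target k.succ i j (ε := ε) (by omega) (by rw [hi, hb, ← hl]; simp)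
      (by rw [hj, hb, ← hl]; simp) ?_
    -- The gap at the event's position in the row without the bend connects to both outer gaps of
    -- the bend.
    exact (key k _ i hlen _ (by simp [Slice.GapPass, h, hi])).symm.trans
      (key k _ (j + 1) hlen _ (by simp [Slice.GapPass, h, hj]))
  | min k i j h hi hj =>
    obtain ⟨l, r, hl, hf⟩ := D.fits k
    simp only [h] at hf
    obtain ⟨ε, ht, hb⟩ := hf
    have hlen : (D.slice k).pos < (D.row k.succ).length + 1 := by
      rw [hb, List.length_append]; omega
    refine bend_source_target k.castSucc i j (ε := ε) (by omega) (by rw [hi, ht, ← hl]; simp)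
      (by rw [hj, ht, ← hl]; simp) ?_
    exact (key k i _ _ hlen (by simp [Slice.GapPass, h, hi])).trans
      (key k (j + 1) _ _ hlen (by simp [Slice.GapPass, h, hj])).symm

/-- The region from which the normal vector of a semi-arc points. -/
def sourceRegion : D.SemiArc → D.Region :=
  Quot.lift (fun s => D.region (D.source s)) fun _ _ h => h.source_target.1

/-- The region to which the normal vector of a semi-arc points. -/
def targetRegion : D.SemiArc → D.Region :=
  Quot.lift (fun s => D.region (D.target s)) fun _ _ h => h.source_target.2

theorem Crossing.down_eq (c : D.Crossing) :
    D.down c.nw = D.down c.se ∧ D.down c.ne = D.down c.sw := by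
  obtain ⟨⟨k, b⟩, hk⟩ := c
  obtain ⟨hr0, hr1⟩ := D.crossing_row ⟨(k, b), hk⟩
  obtain ⟨l, r, hl, h⟩ := D.fits k
  rw [hk] at h
  obtain ⟨ε, δ, h1, h2⟩ := h
  have e0 : (D.row k.castSucc)[(D.slice k).pos]? = some ε := by rw [h1, ← hl]; simp
  have e1 : (D.row k.castSucc)[(D.slice k).pos + 1]? = some δ := by rw [h1, ← hl]; simp
  have e2 : (D.row k.succ)[(D.slice k).pos]? = some δ := by rw [h2, ← hl]; simp
  have e3 : (D.row k.succ)[(D.slice k).pos + 1]? = some ε := by rw [h2, ← hl]; simp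
  have hr0' : (D.slice k).pos + 1 < (D.row k.castSucc).length := hr0
  have hr1' : (D.slice k).pos + 1 < (D.row k.succ).length := hr1
  rw [List.getElem?_eq_getElem (by omega)] at e0 e1 e2 e3
  exact ⟨(Option.some.inj e0).trans (Option.some.inj e3).symm,
    (Option.some.inj e1).trans (Option.some.inj e2).symm⟩

/-- The regions on the two sides of each of the four ends of a crossing. -/
theorem Crossing.regions (c : D.Crossing) :
    sourceRegion c.ends.i = c.specified ∧ sourceRegion c.ends.j = c.specified ∧
      sourceRegion c.ends.k = targetRegion c.ends.j ∧
      sourceRegion c.ends.l = targetRegion c.ends.i := by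
  obtain ⟨d1, d2⟩ := c.down_eq
  -- `west` and `east` are gaps of the upper row, whereas the sides of the lower ends are gaps of
  -- the lower row.
  have hw : D.region c.west = D.region ⟨c.1.1.succ, c.sw.2.castSucc⟩ :=
    Quot.sound (.pass c.1.1 _ _ (by simp [Slice.GapPass, c.2, sw]))
  have he : D.region c.east = D.region ⟨c.1.1.succ, c.se.2.succ⟩ :=
    Quot.sound (.pass c.1.1 _ _ (by simp [Slice.GapPass, c.2, se]))
  have nwS : sourceRegion (D.semiArc c.nw) =
      if D.down c.nw then D.region c.west else D.region c.north := by
    show D.region (D.source c.nw) = _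
    unfold source
    cases D.down c.nw <;> rfl
  have nwT : targetRegion (D.semiArc c.nw) =
      if D.down c.nw then D.region c.north else D.region c.west := by
    show D.region (D.target c.nw) = _
    unfold target
    cases D.down c.nw <;> rfl
  have neS : sourceRegion (D.semiArc c.ne) =
      if D.down c.ne then D.region c.north else D.region c.east := by
    show D.region (D.source c.ne) = _
    unfold source
    cases D.down c.ne <;> rfl
  have neT : targetRegion (D.semiArc c.ne) =
      if D.down c.ne then D.region c.east else D.region c.north := by
    show D.region (D.target c.ne) = _
    unfold target
    cases D.down c.ne <;> rfl
  have swS : sourceRegion (D.semiArc c.sw) =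
      if D.down c.ne then D.region c.west else D.region c.south := by
    show D.region (D.source c.sw) = _
    unfold source
    rw [hw, d2]
    cases D.down c.sw <;> rfl
  have swT : targetRegion (D.semiArc c.sw) =
      if D.down c.ne then D.region c.south else D.region c.west := by
    show D.region (D.target c.sw) = _
    unfold target
    rw [hw, d2]
    cases D.down c.sw <;> rfl
  have seS : sourceRegion (D.semiArc c.se) =
      if D.down c.nw then D.region c.south else D.region c.east := by
    show D.region (D.source c.se) = _
    unfold source
    rw [he, d1]
    cases D.down c.se <;> rfl
  have seT : targetRegion (D.semiArc c.se) =
      if D.down c.nw then D.region c.east else D.region c.south := by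
    show D.region (D.target c.se) = _
    unfold target
    rw [he, d1]
    cases D.down c.se <;> rfl
  unfold ends specified
  generalize D.down c.nw = ε at *
  generalize D.down c.ne = δ at *
  generalize c.1.2 = b
  cases b <;> cases ε <;> cases δ <;>
    simp [crossingEnds, specifiedQuadrant, nwS, nwT, neS, neT, swS, swT, seS, seT]

/-! ### The bijection between the colorings -/

section

variable {Y : Type u} [Biquandle Y]

theorem IsRegionColoring.semiArc {C : D.BiquandleColoring Y} {R : D.Region → As Y}
    (h : IsRegionColoring C R) (σ : D.SemiArc) :
    R (sourceRegion σ) * gen (C.1 σ) = R (targetRegion σ) := by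
  obtain ⟨s, rfl⟩ := Quot.exists_rep σ
  exact h.cross s

theorem region_zero (k : Fin (D.len + 1)) : D.region ⟨k, 0⟩ = D.unbounded := by
  induction k using Fin.induction with
  | zero => rfl
  | succ k ih =>
    rw [← ih]
    refine (Quot.sound (.pass k 0 0 ?_)).symm
    unfold Slice.GapPass
    split <;> simp

theorem IsRegionColoring.region_succ {C : D.BiquandleColoring Y} {R : D.Region → As Y}
    (h : IsRegionColoring C R) (s : D.Piece) :
    R (D.region ⟨s.1, s.2.succ⟩) =
      R (D.region ⟨s.1, s.2.castSucc⟩) * signedGen (D.down s, C.1 (D.semiArc s)) := by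
  have := h.cross s
  unfold source target at this
  unfold signedGen
  cases hd : D.down s <;> simp only [hd, if_true, if_false, Bool.false_eq_true] at this ⊢
  · rw [← this, mul_inv_cancel_right]
  · exact this.symm

end

variable {X : Type u} [Biquandle X]

/-- The biquandle coloring by `X` in which a semi-arc has the color `psi p a`, where `a` is its
color in a coloring by `Q(X)` and `p` is the color of the region from which its normal vector
points. -/
noncomputable def toBiquandleColoring (C : D.QuandleColoring (Qdl X)) : D.BiquandleColoring X :=
  ⟨fun σ => psi (regionColoring C.toBiquandle (sourceRegion σ)) (C.1 (D.toArc σ)), fun c => by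
    obtain ⟨hi, hj, hk, hl⟩ := c.regions
    have hR := regionColoring_spec C.toBiquandle
    constructor
    · show underOp (psi _ (C.1 (D.toArc c.ends.i))) (psi _ (C.1 (D.toArc c.ends.j))) =
        psi _ (C.1 (D.toArc c.ends.k))
      -- The source region of the end `k` lies across the over-string from the specified region,
      -- that of `l` across the under-string.
      rw [← C.2 c, hk, ← hR.semiArc, hi, hj]
      exact (psi_mul_gen_act _ _ _).symm
    · show overOp (psi _ (C.1 (D.toArc c.ends.j))) (psi _ (C.1 (D.toArc c.ends.i))) =
        psi _ (C.1 (D.toArc c.ends.l))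
      rw [c.toArc_l, hl, ← hR.semiArc, hi, hj]
      exact (psi_mul_gen _ _ _).symm⟩

theorem asStep_toBiquandleColoring (C : D.QuandleColoring (Qdl X)) (σ : D.SemiArc) :
    asStep ((toBiquandleColoring C).1 σ) (regionColoring C.toBiquandle (sourceRegion σ)) =
      regionColoring C.toBiquandle (targetRegion σ) :=
  (asStep_psi _ _).trans ((regionColoring_spec C.toBiquandle).semiArc σ)

/-- A map on the regions that changes by `asStep` at each semi-arc is determined by the coloring
of the semi-arcs. -/
theorem region_map_unique {C : D.SemiArc → X} {R R' : D.Region → As (Qdl X)}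
    (h0 : R D.unbounded = R' D.unbounded)
    (h : ∀ σ, asStep (C σ) (R (sourceRegion σ)) = R (targetRegion σ))
    (h' : ∀ σ, asStep (C σ) (R' (sourceRegion σ)) = R' (targetRegion σ)) : R = R' := by
  funext r
  obtain ⟨⟨k, g⟩, rfl⟩ := Quot.exists_rep r
  show R (D.region ⟨k, g⟩) = R' (D.region ⟨k, g⟩)
  induction g using Fin.induction with
  | zero => rw [region_zero, h0]
  | succ g ih =>
    have hs : asStep _ (R (D.region (D.source ⟨k, g⟩))) = R (D.region (D.target ⟨k, g⟩)) :=
      h (D.semiArc ⟨k, g⟩)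
    have hs' : asStep _ (R' (D.region (D.source ⟨k, g⟩))) = R' (D.region (D.target ⟨k, g⟩)) :=
      h' (D.semiArc ⟨k, g⟩)
    unfold source target at hs hs'
    cases hd : D.down ⟨k, g⟩ <;>
      simp only [hd, if_true, if_false, Bool.false_eq_true] at hs hs'
    · rw [← ih] at hs'
      -- The normal of an upward string points to the left, so the color on its right is recovered
      -- by inverting `asStep`.
      exact (asStep _).injective (hs.trans hs'.symm)
    · rw [← hs, ← hs', ih]

/-- The image determines the region colors in `As(Q(X))` by `region_map_unique`; with these known,
injectivity of `psi p` determines the quandle colors. -/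
theorem toBiquandleColoring_injective :
    Injective (toBiquandleColoring : D.QuandleColoring (Qdl X) → D.BiquandleColoring X) := by
  intro C C' h
  have hR : regionColoring C.toBiquandle = regionColoring C'.toBiquandle := by
    refine region_map_unique (C := (toBiquandleColoring C).1) ?_
      (asStep_toBiquandleColoring C) ?_
    · rw [(regionColoring_spec _).unbounded, (regionColoring_spec _).unbounded]
    · rw [h]
      exact asStep_toBiquandleColoring C'
  apply Subtype.ext
  funext α
  obtain ⟨s, rfl⟩ := Quot.exists_rep α
  have hs : psi _ (C.1 (D.toArc (D.semiArc s))) = psi _ (C'.1 (D.toArc (D.semiArc s))) :=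
    congrFun (congrArg Subtype.val h) (D.semiArc s)
  rw [hR] at hs
  exact (psi_bijective _).1 hs

/-! ### From biquandle colorings by `X` back to quandle colorings by `Q(X)` -/

/-- The `Q(X)`-colors of the semi-arcs determined by a biquandle coloring by `X`. -/
noncomputable def derivedColor (C : D.BiquandleColoring X) (σ : D.SemiArc) : Qdl X :=
  psiInv (asOrbit (regionColoring C (sourceRegion σ))) (C.1 σ)

theorem asOrbit_targetRegion (C : D.BiquandleColoring X) (σ : D.SemiArc) :
    asOrbit (regionColoring C (targetRegion σ)) =
      asOrbit (regionColoring C (sourceRegion σ)) * gen (derivedColor C σ) := by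
  rw [← (regionColoring_spec C).semiArc, asOrbit_mul_gen, asStep_apply, derivedColor]

theorem psi_derivedColor (C : D.BiquandleColoring X) (σ : D.SemiArc) :
    psi (asOrbit (regionColoring C (sourceRegion σ))) (derivedColor C σ) = C.1 σ :=
  psi_psiInv _ _

/-- Compared after applying the bijection `psi p` for the source region of `l`, the claim becomes
the overlined half of the biquandle rule. This is what lets the color pass along a whole arc. -/
theorem derivedColor_l (C : D.BiquandleColoring X) (c : D.Crossing) :
    derivedColor C c.ends.l = derivedColor C c.ends.j := by
  obtain ⟨hi, hj, -, hl⟩ := c.regions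
  have hij := C.2 c |>.2
  apply (psi_bijective (asOrbit (regionColoring C (sourceRegion c.ends.l)))).1
  rw [psi_derivedColor, hl, asOrbit_targetRegion, psi_mul_gen, psi_derivedColor, hi, ← hj,
    psi_derivedColor]
  exact hij.symm

theorem derivedColor_k (C : D.BiquandleColoring X) (c : D.Crossing) :
    derivedColor C c.ends.k = Shelf.act (derivedColor C c.ends.j) (derivedColor C c.ends.i) := by
  obtain ⟨hi, hj, hk, -⟩ := c.regions
  have hij := C.2 c |>.1
  apply (psi_bijective (asOrbit (regionColoring C (sourceRegion c.ends.k)))).1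
  rw [psi_derivedColor, hk, asOrbit_targetRegion, psi_mul_gen_act, psi_derivedColor, hj, ← hi,
    psi_derivedColor]
  exact hij.symm

theorem derivedColor_overJoined (C : D.BiquandleColoring X) {s t : D.Piece}
    (h : D.OverJoined s t) : derivedColor C (D.semiArc s) = derivedColor C (D.semiArc t) := by
  cases h with
  | joined h => exact congrArg (derivedColor C) (Quot.sound h)
  | leftOver k i j h hi hj =>
    let c : D.Crossing := ⟨(k, true), h⟩
    have hs : (⟨k.castSucc, i⟩ : D.Piece) = c.nw := congrArg (Sigma.mk _) (Fin.ext hi)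
    have ht : (⟨k.succ, j⟩ : D.Piece) = c.se := congrArg (Sigma.mk _) (Fin.ext hj)
    rw [hs, ht]
    have := derivedColor_l C c
    unfold Crossing.ends crossingEnds at this
    -- The orientation of the under-string decides which half of the over-string is the end `j`.
    cases hd : D.down c.ne <;> simp only [hd, c, if_true, if_false, Bool.false_eq_true] at this
    · exact this
    · exact this.symm
  | rightOver k i j h hi hj =>
    let c : D.Crossing := ⟨(k, false), h⟩
    have hs : (⟨k.castSucc, i⟩ : D.Piece) = c.ne := congrArg (Sigma.mk _) (Fin.ext hi)
    have ht : (⟨k.succ, j⟩ : D.Piece) = c.sw := congrArg (Sigma.mk _) (Fin.ext hj)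
    rw [hs, ht]
    have := derivedColor_l C c
    unfold Crossing.ends crossingEnds at this
    cases hd : D.down c.nw <;> simp only [hd, c, if_true, if_false, Bool.false_eq_true] at this
    · exact this.symm
    · exact this

/-- The coloring by `Q(X)` determined by a biquandle coloring by `X`. -/
noncomputable def toQuandleColoring (C : D.BiquandleColoring X) : D.QuandleColoring (Qdl X) :=
  ⟨Quot.lift (fun s => derivedColor C (D.semiArc s)) fun _ _ => derivedColor_overJoined C,
    fun c => by
      have key : ∀ σ, Quot.lift (fun s => derivedColor C (D.semiArc s))
          (fun _ _ => derivedColor_overJoined C) (D.toArc σ) = derivedColor C σ := fun σ => by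
        obtain ⟨s, rfl⟩ := Quot.exists_rep σ
        rfl
      rw [key, key, key, derivedColor_k]⟩

theorem toQuandleColoring_toArc (C : D.BiquandleColoring X) (σ : D.SemiArc) :
    (toQuandleColoring C).1 (D.toArc σ) = derivedColor C σ := by
  obtain ⟨s, rfl⟩ := Quot.exists_rep σ
  rfl

/-- By uniqueness of region colorings: the orbit map changes by `gen (derivedColor C σ)` across each
semi-arc. -/
theorem regionColoring_toQuandleColoring (C : D.BiquandleColoring X) :
    regionColoring (toQuandleColoring C).toBiquandle =
      fun r => asOrbit (regionColoring C r) := by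
  refine (existsUnique_regionColoring _).unique (regionColoring_spec _) ⟨?_, fun s => ?_⟩
  · rw [(regionColoring_spec C).unbounded, asOrbit_one]
  · exact (asOrbit_targetRegion C (D.semiArc s)).symm

theorem toBiquandleColoring_toQuandleColoring (C : D.BiquandleColoring X) :
    toBiquandleColoring (toQuandleColoring C) = C := by
  apply Subtype.ext
  funext σ
  show psi (regionColoring (toQuandleColoring C).toBiquandle _) _ = _
  rw [regionColoring_toQuandleColoring, toQuandleColoring_toArc, psi_derivedColor]

variable (D X) in
/-- The colorings of `D` by `Q(X)` correspond to the biquandle colorings by `X`. -/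
noncomputable def coloringEquiv : D.QuandleColoring (Qdl X) ≃ D.BiquandleColoring X :=
  Equiv.ofBijective toBiquandleColoring
    ⟨toBiquandleColoring_injective, fun C => ⟨_, toBiquandleColoring_toQuandleColoring C⟩⟩

/-! ### Pulling away and weights -/

/-- The row of strings with their orientations and quandle colors. -/
def quandleRow (C : D.QuandleColoring (Qdl X)) (k : Fin (D.len + 1)) : List (Bool × Qdl X) :=
  List.ofFn fun i : Fin (D.row k).length =>
    (D.down ⟨k, i⟩, C.1 (D.toArc (D.semiArc ⟨k, i⟩)))

/-- The downward string is on the left of each pair for either orientation of the original, so the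
doubled row does not show which string is the copy. At the unbounded region `psi 1` is the identity.
-/
theorem doubledRow_eq (C : D.QuandleColoring (Qdl X)) (k : Fin (D.len + 1)) :
    doubledRow C k = pairRow ((quandleRow C k).map fun s => psi 1 s.2) := by
  simp only [doubledRow, pairRow, quandleRow, psi_one, List.ofFn_eq_map, List.flatMap_map,
    List.map_map]
  congr 1
  funext i
  cases D.down ⟨k, i⟩ <;> rfl

/-- The running product along a row is the color of the gap reached, and `pulledRow` evaluates `psi`
at the left gap of a downward string and the right gap of an upward one, which is its source. -/
theorem coloredRow_toBiquandleColoring (C : D.QuandleColoring (Qdl X)) (k : Fin (D.len + 1)) :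
    coloredRow (toBiquandleColoring C) k = pulledRow 1 (quandleRow C k) := by
  have hR := regionColoring_spec C.toBiquandle
  have := pulledRow_ofFn
    (fun i : Fin (D.row k).length => (D.down ⟨k, i⟩, C.1 (D.toArc (D.semiArc ⟨k, i⟩))))
    (fun g => regionColoring C.toBiquandle (D.region ⟨k, g⟩)) (fun i => hR.region_succ ⟨k, i⟩)
  rw [region_zero, hR.unbounded] at this
  refine Eq.trans ?_ this.symm
  unfold coloredRow
  congr 1
  funext i
  refine Prod.ext rfl ?_
  show psi (regionColoring _ (D.region (D.source ⟨k, i⟩))) _ = _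
  unfold source
  cases D.down ⟨k, i⟩ <;> rfl

theorem isPullAway_toBiquandleColoring (C : D.QuandleColoring (Qdl X)) :
    IsPullAway C (toBiquandleColoring C) := by
  intro k
  obtain ⟨copies, h⟩ := braidColoring_pulledRow 1 (quandleRow C k) [] []
  refine ⟨copies, ?_⟩
  have hrow : (quandleRow C k).map Prod.fst = D.row k := by
    rw [quandleRow, List.map_ofFn]
    exact List.ofFn_getElem
  rw [pullAwayWord_eq, coloredRow_toBiquandleColoring, doubledRow_eq]
  simpa [hrow] using h

theorem isPullAway_iff (C : D.QuandleColoring (Qdl X)) (C' : D.BiquandleColoring X) :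
    IsPullAway C C' ↔ C' = toBiquandleColoring C := by
  refine ⟨fun h => ?_, fun h => h ▸ isPullAway_toBiquandleColoring C⟩
  apply Subtype.ext
  funext σ
  obtain ⟨⟨k, i⟩, rfl⟩ := Quot.exists_rep σ
  obtain ⟨copies, h⟩ := h k
  obtain ⟨copies', h'⟩ := isPullAway_toBiquandleColoring C k
  -- The strings of the diagram form prefixes of equal length, so equality of the bottom rows splits
  -- off the copies.
  have hrow := (List.append_inj (h.bottom_unique h') (by simp [coloredRow])).1
  exact congrArg Prod.snd (congrFun (List.ofFn_injective hrow) i)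

theorem weight_toBiquandleColoring {A : Type v} [AddCommGroup A] (θ : X × X → A)
    (C : D.QuandleColoring (Qdl X)) (c : D.Crossing) :
    c.biquandleWeight θ (toBiquandleColoring C) = c.shadowWeight (pullback θ) C := by
  obtain ⟨hi, hj, -, -⟩ := c.regions
  unfold Crossing.biquandleWeight Crossing.shadowWeight pullback
  show c.sign • θ (psi _ _, psi _ _) = _
  rw [hi, hj]

theorem invariant_toBiquandleColoring {A : Type v} [AddCommGroup A] (θ : X × X → A)
    (C : D.QuandleColoring (Qdl X)) :
    D.biquandleInvariant θ (toBiquandleColoring C) = D.shadowInvariant (pullback θ) C :=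
  Finset.sum_congr rfl fun c _ => weight_toBiquandleColoring θ C c

end LinkDiagram

end BiquandleLink

theorem theorem5p1 {X : Type*} [Biquandle X] {A : Type*} [AddCommGroup A]
    (θ : X × X → A) (hθ : IsBiquandleCocycle θ) :
    IsShadowCocycle (pullback θ) ∧
    ∀ D : LinkDiagram, ∃ Ψ : D.QuandleColoring (Qdl X) ≃ D.BiquandleColoring X,
      (∀ (C : D.QuandleColoring (Qdl X)) (C' : D.BiquandleColoring X),
        LinkDiagram.IsPullAway C C' ↔ C' = Ψ C) ∧
      (∀ (C : D.QuandleColoring (Qdl X)) (c : D.Crossing),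
        c.biquandleWeight θ (Ψ C) = c.shadowWeight (pullback θ) C) ∧
      (∀ C : D.QuandleColoring (Qdl X),
        D.biquandleInvariant θ (Ψ C) = D.shadowInvariant (pullback θ) C) ∧
      (∀ _ : Finite X,
        D.biquandleInvariantSum θ = D.shadowInvariantSum (pullback θ)) := by
  refine ⟨isShadowCocycle_pullback hθ, fun D => ⟨D.coloringEquiv X, LinkDiagram.isPullAway_iff,
    LinkDiagram.weight_toBiquandleColoring θ, LinkDiagram.invariant_toBiquandleColoring θ,
    fun _ => ?_⟩⟩
  -- Equality in the group ring is a reindexing of the sum along the bijection, since corresponding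
  -- colorings have the same invariant.
  refine (finsum_eq_of_bijective (D.coloringEquiv X) (D.coloringEquiv X).bijective
    fun C => ?_).symm
  rw [← LinkDiagram.invariant_toBiquandleColoring θ C]
  rfl
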